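/- Let $k$ be a field, let $n\ge 1$ and $0<b<a$ be integers, let $R=k[x_1,\dots,x_n]$, and let $I=(x_1^a,\dots,x_n^a,(x_1\cdots x_n)^b)\subset R$ (a uniform monomial ideal). Let $S=R[y_1,\dots,y_n,w]$ and let the Rees ideal $\mathcal I$ be the kernel of the map of $R$-algebras $S\to R[It]$, $y_j\mapsto x_j^a t$, $w\mapsto (x_1\cdots x_n)^b t$. The external degree on $S$ is the one in which the $y_j$ and $w$ have degree $1$ and the $x_i$ have degree $0$. The relation type of $I$ is the least $N$ such that $\mathcal I$ is generated by forms of external degree at most $N$. Let $$Q=\begin{cases}(x_1^a,\dots,x_n^a) & \text{if } a\le nb,\\ (x_1^a-x_n^a,\dots,x_{n-1}^a-x_n^a,(x_1\cdots x_n)^b) & \text{if } nb<a,\end{cases}$$ and let $r$ be the reduction number of $I$ with respect to the reduction $Q$, i.e. the least $m\ge 0$ with $QI^m=I^{m+1}$. Let $\mathcal K$ be the set of the Koszul syzygies $K_{ij}=x_i^ay_j-x_j^ay_i$, $1\le i<j\le n$, and put $L_i=x_i^{a-b}w-P(i)^{b}y_i$. For a non-empty subset $s=\{i_1,\dots,i_\delta\}$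 of $\{1,\dots,n\}$ let $P(s)=P(i_1,\dots,i_\delta)=\prod_{j\notin s}x_j$ and $$H_s=(x_{i_1}\cdots x_{i_\delta})^{a-\delta b}\,w^\delta-P(s)^{\delta b}\,y_{i_1}\cdots y_{i_\delta},$$ where, if $a<\delta b$, the factor $(x_{i_1}\cdots x_{i_\delta})^{a-\delta b}$ is removed from the first term and $(x_{i_1}\cdots x_{i_\delta})^{\delta b-a}$ is put into the second one instead. Then $Q$ is a reduction of $I$, $r+1\le n$, and the following hold. (a) For every subset $s_0$ with $r+1$ elements, $\mathcal I$ is generated by the set $G$ consisting of the $\binom n2$ Koszul syzygies $K_{ij}$, the $H_s$ with $1\le |s|\le r$, and $H_{s_0}$. This set has exactly $$N=\binom n2+\sum_{\delta=1}^r\binom n\delta+1$$ elements. Each of them is a binomial which is homogeneous for the following weights: $x_i$ has weight $1$; if $a\le nb$, then $y_j$ has weight $1$ and $w$ has weight $nb-a+1$; if $nb<a$, then $y_j$ has weight $a-nb+1$ and $w$ has weight $1$. If $n\ne 2$, then no set with fewer than $N$ elements generates $\mathcal I$. (b) Each element of $G$ is obtained from the syzygy forms $K_{ij}$ ($i<j$)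 and $L_i$ as an iterated Sylvester form: it belongs to the smallest class of forms that contains the $K_{ij}$ and $L_i$ and that contains, with a form $g$ of external degree $d$, every Sylvester form of $f$ and $g$ for each syzygy form $f$. Here $h$ is a Sylvester form of $f$ and $g$ if there are a regular sequence $u,v$ in $R$ and a $2\times 2$ matrix $M$ over $S$, whose first row consists of forms of external degree $1$ and whose second row consists of forms of external degree $d$, with $\binom fg=M\binom uv$ and $h=\det M$. (c) The relation type of $I$ is $r+1$. -/

import Mathlib

open MvPolynomial

noncomputable section

namespace UniformRees

/-- The variables `x_1, …, x_n, y_1, …, y_n, w` of `S = k[x, y, w]`. -/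
inductive RVar (n : ℕ) : Type
  | x (i : Fin n) : RVar n
  | y (i : Fin n) : RVar n
  | w : RVar n

/-- The polynomial ring `R = k[x_1, …, x_n]`. -/
abbrev R (k : Type*) [Field k] (n : ℕ) := MvPolynomial (Fin n) k

/-- The polynomial ring `S = R[y_1, …, y_n, w] = k[x, y, w]`. -/
abbrev S (k : Type*) [Field k] (n : ℕ) := MvPolynomial (RVar n) k

variable (k : Type*) [Field k] (n a b : ℕ)

/-- The uniform monomial ideal `I = (x_1^a, …, x_n^a, (x_1 ⋯ x_n)^b)` of `R`. -/
def uniformIdeal : Ideal (R k n) :=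
  Ideal.span (Set.range (fun i : Fin n => (X i : R k n) ^ a) ∪ {(∏ i : Fin n, (X i : R k n)) ^ b})

theorem pow_mem_uniformIdeal (i : Fin n) : (X i : R k n) ^ a ∈ uniformIdeal k n a b :=
  Ideal.subset_span (Or.inl ⟨i, rfl⟩)

theorem prod_mem_uniformIdeal :
    (∏ i : Fin n, (X i : R k n)) ^ b ∈ uniformIdeal k n a b :=
  Ideal.subset_span (Or.inr rfl)

/-- The degree-one element `f t` of the Rees algebra `R[It]`, for `f ∈ I`. -/
def degOne {A : Type*} [CommRing A] (I : Ideal A) (f : A) (hf : f ∈ I) : reesAlgebra I :=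
  ⟨Polynomial.monomial 1 f, by
    rw [mem_reesAlgebra_iff_support]
    intro i hi
    have h1 : i = 1 := by
      by_contra h
      exact (Polynomial.mem_support_iff.mp hi)
        (Polynomial.coeff_monomial_of_ne f h)
    subst h1
    simpa using hf⟩

/-- The presentation `S → R[It]` of the Rees algebra of `I`:
`x_i ↦ x_i`, `y_i ↦ x_i^a t`, `w ↦ (x_1 ⋯ x_n)^b t`. -/
def presentation : S k n →ₐ[k] reesAlgebra (uniformIdeal k n a b) :=
  aeval (fun v => match v with
    | RVar.x i => algebraMap (R k n) (reesAlgebra (uniformIdeal k n a b)) (X i)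
    | RVar.y i => degOne _ ((X i) ^ a) (pow_mem_uniformIdeal k n a b i)
    | RVar.w => degOne _ ((∏ i, X i) ^ b) (prod_mem_uniformIdeal k n a b))

/-- The Rees ideal of `I`: the kernel of `S → R[It]`. -/
def reesIdeal : Ideal (S k n) := RingHom.ker (presentation k n a b)

/-- `red_J(I)`: the least `m` such that `J I^m = I^(m+1)`. -/
def reductionNumberWrt {A : Type*} [CommRing A] (J I : Ideal A) : ℕ :=
  sInf {m : ℕ | J * I ^ m = I ^ (m + 1)}

/-- The distinguished minimal reduction of `I`: it is `(x_1^a, …, x_n^a)` if `a ≤ n b`, and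
`(x_1^a - x_n^a, …, x_{n-1}^a - x_n^a, (x_1 ⋯ x_n)^b)` if `n b < a`.
(The index `l` with `l + 1 = n` is that of the last variable; `i = l` adds the generator `0`.) -/
def uniformReduction : Ideal (R k n) :=
  if a ≤ n * b then
    Ideal.span (Set.range fun i : Fin n => (X i : R k n) ^ a)
  else
    Ideal.span ({f : R k n | ∃ i l : Fin n, l.val + 1 = n ∧ f = X i ^ a - X l ^ a} ∪
      {(∏ i : Fin n, (X i : R k n)) ^ b})

/-- The reduction number of the uniform monomial ideal `I`. -/
def redNumber : ℕ := reductionNumberWrt (uniformReduction k n a b) (uniformIdeal k n a b)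

/-- The weights on `S`: `x_i` has weight `1`; if `a ≤ n b` then `y_j` has weight `1` and `w` has
weight `n b - a + 1`; otherwise `y_j` has weight `a - n b + 1` and `w` has weight `1`. -/
def quasiWeight : RVar n → ℕ
  | RVar.x _ => 1
  | RVar.y _ => if a ≤ n * b then 1 else a - n * b + 1
  | RVar.w => if a ≤ n * b then n * b - a + 1 else 1

/-- The external (presentation) degree: `x_i` has degree `0`, `y_j` and `w` have degree `1`. -/
def extWeight : RVar n → ℕ
  | RVar.x _ => 0
  | RVar.y _ => 1
  | RVar.w => 1

variable {k n} in
/-- A binomial: the difference of two distinct monomials. -/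
def IsBinomial (f : S k n) : Prop :=
  ∃ m m' : RVar n →₀ ℕ, m ≠ m' ∧ f = monomial m 1 - monomial m' 1

variable {n} in
/-- The Koszul syzygy `K_{ij} = x_i^a y_j - x_j^a y_i`. -/
def koszul (i j : Fin n) : S k n :=
  X (RVar.x i) ^ a * X (RVar.y j) - X (RVar.x j) ^ a * X (RVar.y i)

variable {n} in
/-- The reduced syzygy `L_i = x_i^(a-b) w - P(i)^b y_i`, where `P(i) = ∏_{j ≠ i} x_j`. -/
def taylor (i : Fin n) : S k n :=
  X (RVar.x i) ^ (a - b) * X RVar.w - (∏ j ∈ {i}ᶜ, X (RVar.x j)) ^ b * X (RVar.y i)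

variable {n} in
/-- For `s = {i_1, …, i_δ}` and `P(s) = ∏_{j ∉ s} x_j`, the binomial
`(x_{i_1} ⋯ x_{i_δ})^(a - δb) w^δ - P(s)^(δb) y_{i_1} ⋯ y_{i_δ}` if `δb ≤ a`, and
`w^δ - P(s)^(δb) (x_{i_1} ⋯ x_{i_δ})^(δb - a) y_{i_1} ⋯ y_{i_δ}` if `a ≤ δb`.
Both cases are covered at once by the truncated subtraction of natural numbers. -/
def sylvBinomial (s : Finset (Fin n)) : S k n :=
  (∏ i ∈ s, X (RVar.x i)) ^ (a - s.card * b) * X RVar.w ^ s.card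
    - (∏ j ∈ sᶜ, X (RVar.x j)) ^ (s.card * b) * (∏ i ∈ s, X (RVar.x i)) ^ (s.card * b - a)
      * ∏ i ∈ s, X (RVar.y i)

/-- The set of all Koszul syzygies `K_{ij}`, `i < j`. -/
def koszulForms : Set (S k n) := {f | ∃ i j : Fin n, i < j ∧ f = koszul k a i j}

/-- The syzygy forms: the `K_{ij}` with `i < j`, and the `L_i`. -/
def syzygyForms : Set (S k n) := koszulForms k n a ∪ Set.range (taylor k a b)

variable {n} in
/-- The Koszul syzygies, the binomials of all non-empty index sets with at most `r` elements, and
the binomial of one further index set `s₀`. -/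
def generators (r : ℕ) (s₀ : Finset (Fin n)) : Set (S k n) :=
  koszulForms k n a
    ∪ {f | ∃ s : Finset (Fin n), 1 ≤ s.card ∧ s.card ≤ r ∧ f = sylvBinomial k a b s}
    ∪ {sylvBinomial k a b s₀}

variable {k n} in
/-- `h` is a Sylvester form of `f` and `g` (forms of external degrees `d` and `e`): there are a
complete intersection `u, v` in `R` and a content matrix `M` over `S`, whose rows consist of forms
of external degrees `d` and `e`, such that `(f, g)ᵗ = M (u, v)ᵗ` and `h = det M`. -/
def IsSylvesterForm (d e : ℕ) (f g h : S k n) : Prop :=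
  ∃ u v : R k n, RingTheory.Sequence.IsRegular (R k n) [u, v] ∧
    ∃ M : Matrix (Fin 2) (Fin 2) (S k n),
      (∀ j, IsWeightedHomogeneous (extWeight n) (M 0 j) d) ∧
      (∀ j, IsWeightedHomogeneous (extWeight n) (M 1 j) e) ∧
      M.mulVec ![rename RVar.x u, rename RVar.x v] = ![f, g] ∧
      h = M.det

/-- Forms obtained iteratively from the syzygy forms: a syzygy form has step index `1`, and a
Sylvester form of a syzygy form and a form with index `d` has index `d + 1`. The index is the
external degree. -/
inductive IsIteratedSylvesterForm : ℕ → S k n → Prop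
  | syzygy (f : S k n) (hf : f ∈ syzygyForms k n a b) : IsIteratedSylvesterForm 1 f
  | step (d : ℕ) (f g h : S k n) (hf : f ∈ syzygyForms k n a b)
      (hg : IsIteratedSylvesterForm d g) (hh : IsSylvesterForm 1 d f g h) :
      IsIteratedSylvesterForm (d + 1) h

/-- The relation type of `I`: the least `N` such that the Rees ideal is generated by its
forms of external degree at most `N`. -/
def relationType : ℕ :=
  sInf {N : ℕ | Ideal.span {f : S k n | f ∈ reesIdeal k n a b ∧
    ∃ d ≤ N, IsWeightedHomogeneous (extWeight n) f d} = reesIdeal k n a b}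

end UniformRees

end

/-!
Write `p = r + 1`. The proof uses `r` only through three inequalities (`redNumber_spec`):
`r b < a`, `p ≤ n`, and `a ≤ p b` or `p = n`. In other words, `p` is the least `δ` with `a ≤ δ b`,
or `n` if that is less. If `a ≤ n b`, put `c = (x_1 ⋯ x_n)^b`. Then `c ^ p` is divisible by a
product of `p` of the `x_i^a`, whereas `c ^ (m + 1) ∉ Q` for `m + 1 < p`. If `n b < a`, then
`x_n^(a n)` is congruent modulo `Q I^(n-1)` to `x_1^a ⋯ x_n^a`, a multiple of `c ^ n`; and the
linear functional `powFunctional` vanishes on `Q` but not at `x_n^(a (m + 1))` for `m + 1 < n`.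

*Generation.* The presentation of the Rees algebra maps monomials to monomials, so that the Rees
ideal is spanned by the differences of monomials with the same image (`reesIdeal_le_of_monomials`).
Such a difference is reduced by induction on the external degree, a common factor `y_i` or `w`
being cancelled. If both monomials are divisible by some `y`, a Koszul syzygy creates a common
factor `y_i` (`FibreMem.of_y`). Otherwise, up to order, one of them involves only `x` and a power
`w ^ d`, while the other one is free of `w` (`FibreMem.of_pure`). Then `H_{s₀}` applies to the
first if `a ≤ p b` and `p ≤ d`, and `H_s` applies to the second otherwise, where `s` is the set of
all `i` such that `y_i` divides it.

*Minimality and relation type.* A monomial is called isolated if it has no common variable with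
any other monomial of its fibre. The coefficient at an isolated monomial is a functional on the
Rees ideal that vanishes on its product with the irrelevant maximal ideal
(`IsIsolated.coeff_mul`). The monomial of `H_s` divisible by `w` is isolated, and so is `x_i^a y_j`
if `n ≥ 3`; these functionals are dual to the given generators (`coeff_indexForm`), which are
therefore a minimal generating set. As `H_{s₀}` has external degree `p`, its functional also shows
that forms of smaller degree do not suffice.

*Sylvester forms.* `H_{s ∪ {i}}` is a Sylvester form of `L_i` and `H_s` with respect to powers
of `x_i` and `∏_{j ∈ s} x_j` (`isSylvesterForm_sylvBinomial`).
-/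

noncomputable section

namespace UniformRees

/-! ### Exponents of monomials and the fibres of the presentation -/

section Exponents

variable {n : ℕ}

/-- The variables of `S` as a disjoint union. -/
def RVar.equivSum (n : ℕ) : RVar n ≃ (Fin n ⊕ Fin n) ⊕ Unit where
  toFun
    | RVar.x i => Sum.inl (Sum.inl i)
    | RVar.y i => Sum.inl (Sum.inr i)
    | RVar.w => Sum.inr ()
  invFun
    | Sum.inl (Sum.inl i) => RVar.x i
    | Sum.inl (Sum.inr i) => RVar.y i
    | Sum.inr () => RVar.w
  left_inv := by rintro (i | i | _) <;> rfl
  right_inv := by rintro ((i | i) | _) <;> rfl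

instance : Fintype (RVar n) := Fintype.ofEquiv _ (RVar.equivSum n).symm

instance : DecidableEq (RVar n) := (RVar.equivSum n).decidableEq

@[to_additive]
theorem RVar.prod_univ {M : Type*} [CommMonoid M] (f : RVar n → M) :
    ∏ v, f v = (∏ i, f (RVar.x i)) * (∏ i, f (RVar.y i)) * f RVar.w := by
  rw [← Equiv.prod_comp (RVar.equivSum n).symm, Fintype.prod_sum_type, Fintype.prod_sum_type]
  simp [RVar.equivSum]

/-- The exponent of the monomial `x^α y^γ w^e` of `S`. -/
def expo (α γ : Fin n → ℕ) (e : ℕ) : RVar n →₀ ℕ :=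
  Finsupp.equivFunOnFinite.symm fun v => match v with
    | RVar.x i => α i
    | RVar.y i => γ i
    | RVar.w => e

@[simp] theorem expo_x (α γ : Fin n → ℕ) (e : ℕ) (i : Fin n) : expo α γ e (RVar.x i) = α i := rfl
@[simp] theorem expo_y (α γ : Fin n → ℕ) (e : ℕ) (i : Fin n) : expo α γ e (RVar.y i) = γ i := rfl
@[simp] theorem expo_w (α γ : Fin n → ℕ) (e : ℕ) : expo α γ e RVar.w = e := rfl

theorem ext_expo {m m' : RVar n →₀ ℕ} (hx : ∀ i, m (RVar.x i) = m' (RVar.x i))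
    (hy : ∀ i, m (RVar.y i) = m' (RVar.y i)) (hw : m RVar.w = m' RVar.w) : m = m' := by
  ext (i | i | _)
  exacts [hx i, hy i, hw]

theorem le_expo {m m' : RVar n →₀ ℕ} (hx : ∀ i, m (RVar.x i) ≤ m' (RVar.x i))
    (hy : ∀ i, m (RVar.y i) ≤ m' (RVar.y i)) (hw : m RVar.w ≤ m' RVar.w) : m ≤ m' := by
  rintro (i | i | _)
  exacts [hx i, hy i, hw]

theorem monomial_eq_prod {k : Type*} [CommSemiring k] (m : RVar n →₀ ℕ) :
    (monomial m 1 : MvPolynomial (RVar n) k) = (∏ i, X (RVar.x i) ^ m (RVar.x i))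
      * (∏ i, X (RVar.y i) ^ m (RVar.y i)) * X RVar.w ^ m RVar.w := by
  rw [monomial_eq, C_1, one_mul, Finsupp.prod_fintype _ _ (fun _ => pow_zero _), RVar.prod_univ]

/-- The external degree of a monomial, given by its exponent. -/
def extDeg (m : RVar n →₀ ℕ) : ℕ := ∑ i, m (RVar.y i) + m RVar.w

/-- The exponent of the monomial of `R` which is the coefficient of `t ^ extDeg m` in the image
of the monomial with exponent `m`. -/
def xDeg (a b : ℕ) (m : RVar n →₀ ℕ) : Fin n →₀ ℕ :=
  Finsupp.equivFunOnFinite.symm fun i => m (RVar.x i) + a * m (RVar.y i) + b * m RVar.w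

@[simp] theorem xDeg_apply (a b : ℕ) (m : RVar n →₀ ℕ) (i : Fin n) :
    xDeg a b m i = m (RVar.x i) + a * m (RVar.y i) + b * m RVar.w := rfl

theorem extDeg_add (m m' : RVar n →₀ ℕ) : extDeg (m + m') = extDeg m + extDeg m' := by
  simp [extDeg, Finset.sum_add_distrib]; ring

theorem xDeg_add (a b : ℕ) (m m' : RVar n →₀ ℕ) :
    xDeg a b (m + m') = xDeg a b m + xDeg a b m' := by
  ext i; simp; ring

theorem weight_extWeight (m : RVar n →₀ ℕ) : Finsupp.weight (extWeight n) m = extDeg m := by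
  rw [Finsupp.weight_apply, Finsupp.sum_fintype _ _ (fun _ => by simp), RVar.sum_univ]
  simp [extWeight, extDeg]

end Exponents

section Fibre

variable {k : Type*} [Field k] {n a b : ℕ}

/-- The monomial with exponent `m` is mapped to the monomial `x ^ xDeg m * t ^ extDeg m`. -/
theorem presentation_monomial (m : RVar n →₀ ℕ) (c : k) :
    (presentation k n a b (monomial m c) : Polynomial (R k n))
      = Polynomial.monomial (extDeg m) (monomial (xDeg a b m) c) := by
  have h1 : (monomial m c : S k n) = c • monomial m 1 := by rw [smul_monomial]; simp
  have h2 : Polynomial.monomial (extDeg m) (monomial (xDeg a b m) c : R k n)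
      = c • Polynomial.monomial (extDeg m) (monomial (xDeg a b m) (1 : k)) := by
    rw [Polynomial.smul_monomial, smul_monomial]; simp
  rw [h1, h2, map_smul]
  have h3 : (presentation k n a b (monomial m 1) : Polynomial (R k n))
      = Polynomial.monomial (extDeg m) (monomial (xDeg a b m) 1) := by
    rw [monomial_eq_prod]
    change (reesAlgebra _).val (presentation k n a b _) = _
    simp only [map_mul, map_prod, map_pow, presentation, aeval_X]
    have e1 : (monomial (xDeg a b m) 1 : R k n) = ∏ i, ((X i) ^ m (RVar.x i)
        * ((X i) ^ a) ^ m (RVar.y i) * ((X i) ^ b) ^ m RVar.w) := by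
      rw [monomial_eq, C_1, one_mul, Finsupp.prod_fintype _ _ (fun _ => pow_zero _)]
      refine Finset.prod_congr rfl fun i _ => ?_
      rw [xDeg_apply, pow_add, pow_add, pow_mul, pow_mul]
    rw [e1]
    have hx : ∀ f : R k n, (reesAlgebra (uniformIdeal k n a b)).val (algebraMap _ _ f)
        = Polynomial.C f := fun f => rfl
    have hd : ∀ (f : R k n) (hf : f ∈ uniformIdeal k n a b),
        (reesAlgebra (uniformIdeal k n a b)).val (degOne _ f hf) = Polynomial.C f * Polynomial.X := by
      intro f hf
      rw [← pow_one Polynomial.X, Polynomial.C_mul_X_pow_eq_monomial]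
      rfl
    simp only [hx, hd, ← Polynomial.C_mul_X_pow_eq_monomial, extDeg, map_prod, map_mul, map_pow,
      Finset.prod_mul_distrib, pow_add, ← Finset.prod_pow_eq_pow_sum, mul_pow,
      Finset.prod_pow]
    ring
  rw [← h3]
  rfl

/-- The coefficients of the image of `f` are the sums of the coefficients of `f` over the fibres
of the map `m ↦ (extDeg m, xDeg m)`. -/
theorem coeff_presentation (f : S k n) (d : ℕ) (β : Fin n →₀ ℕ) :
    coeff β ((presentation k n a b f : Polynomial (R k n)).coeff d)
      = ∑ m ∈ f.support with (extDeg m, xDeg a b m) = (d, β), coeff m f := by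
  classical
  conv_lhs => rw [f.as_sum]
  rw [map_sum, AddSubmonoidClass.coe_finsetSum, Polynomial.finsetSum_coeff, coeff_sum,
    Finset.sum_filter]
  refine Finset.sum_congr rfl fun m _ => ?_
  rw [presentation_monomial, Polynomial.coeff_monomial]
  by_cases h1 : extDeg m = d <;> simp [h1]

theorem sum_fibre_eq_zero {f : S k n} (hf : f ∈ reesIdeal k n a b) (d : ℕ) (β : Fin n →₀ ℕ) :
    ∑ m ∈ f.support with (extDeg m, xDeg a b m) = (d, β), coeff m f = 0 := by
  rw [← coeff_presentation, (RingHom.mem_ker).1 hf]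
  simp

/-- A difference of two monomials with the same image lies in the Rees ideal. -/
theorem monomial_sub_monomial_mem {m m' : RVar n →₀ ℕ} (h1 : extDeg m = extDeg m')
    (h2 : xDeg a b m = xDeg a b m') :
    (monomial m 1 - monomial m' 1 : S k n) ∈ reesIdeal k n a b := by
  refine (RingHom.mem_ker).2 (Subtype.ext ?_)
  rw [map_sub, AddSubgroupClass.coe_sub, presentation_monomial, presentation_monomial, h1, h2,
    sub_self]
  rfl

/-- The Rees ideal is spanned by differences of monomials in the same fibre: an ideal containing
all of these contains the Rees ideal. -/
theorem reesIdeal_le_of_monomials {J : Ideal (S k n)}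
    (hJ : ∀ m m' : RVar n →₀ ℕ, extDeg m = extDeg m' → xDeg a b m = xDeg a b m' →
      (monomial m 1 - monomial m' 1 : S k n) ∈ J) : reesIdeal k n a b ≤ J := by
  classical
  intro f hf
  let θ : (RVar n →₀ ℕ) → ℕ × (Fin n →₀ ℕ) := fun m => (extDeg m, xDeg a b m)
  let rep : ℕ × (Fin n →₀ ℕ) → (RVar n →₀ ℕ) := Function.invFun θ
  have hrep : ∀ m, θ (rep (θ m)) = θ m := fun m => Function.invFun_eq ⟨m, rfl⟩
  rw [← Ideal.Quotient.eq_zero_iff_mem]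
  have h1 : ∀ m (c : k), Ideal.Quotient.mk J (monomial m c)
      = Ideal.Quotient.mk J (monomial (rep (θ m)) 1) * Ideal.Quotient.mk J (C c) := by
    intro m c
    rw [← map_mul, mul_comm, C_mul_monomial, mul_one, Ideal.Quotient.eq]
    have := J.mul_mem_left (C c) (hJ m (rep (θ m)) (congrArg Prod.fst (hrep m)).symm
      (congrArg Prod.snd (hrep m)).symm)
    rwa [mul_sub, C_mul_monomial, C_mul_monomial, mul_one] at this
  rw [f.as_sum, map_sum, ← Finset.sum_fiberwise_of_maps_to
    (fun m hm => Finset.mem_image_of_mem θ hm)]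
  refine Finset.sum_eq_zero fun q _ => ?_
  have h2 : ∀ m ∈ f.support.filter (fun m => θ m = q),
      Ideal.Quotient.mk J (monomial m (coeff m f))
        = Ideal.Quotient.mk J (monomial (rep q) 1) * Ideal.Quotient.mk J (C (coeff m f)) := by
    intro m hm
    rw [h1, (Finset.mem_filter.1 hm).2]
  rw [Finset.sum_congr rfl h2, ← Finset.mul_sum, ← map_sum, ← map_sum,
    sum_fibre_eq_zero hf q.1 q.2]
  simp

end Fibre

/-! ### The Koszul syzygies and the binomials `H_s` as differences of monomials -/

section Binomials

variable {k : Type*} [Field k] {n : ℕ} (a b : ℕ)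

/-- The exponent of `x_i^a y_j`. -/
def koszulExp (i j : Fin n) : RVar n →₀ ℕ :=
  expo (fun l => if l = i then a else 0) (fun l => if l = j then 1 else 0) 0

/-- The exponent of the monomial of `H_s` which is divisible by `w`. -/
def wExp (s : Finset (Fin n)) : RVar n →₀ ℕ :=
  expo (fun l => if l ∈ s then a - s.card * b else 0) (fun _ => 0) s.card

/-- The exponent of the monomial of `H_s` which is divisible by `y_i` for all `i ∈ s`. -/
def yExp (s : Finset (Fin n)) : RVar n →₀ ℕ :=
  expo (fun l => if l ∈ s then s.card * b - a else s.card * b) (fun l => if l ∈ s then 1 else 0) 0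

variable {a b}

theorem koszul_eq (i j : Fin n) :
    (koszul k a i j) = monomial (koszulExp a i j) 1 - monomial (koszulExp a j i) 1 := by
  rw [monomial_eq_prod, monomial_eq_prod, koszul]
  simp [koszulExp, pow_ite]

theorem sylvBinomial_eq (s : Finset (Fin n)) :
    (sylvBinomial k a b s) = monomial (wExp a b s) 1 - monomial (yExp a b s) 1 := by
  rw [monomial_eq_prod, monomial_eq_prod, sylvBinomial]
  have h : (Finset.univ.filter fun i : Fin n => i ∉ s) = sᶜ := by ext; simp
  have h' : (Finset.univ.filter fun i : Fin n => i ∈ s) = s := by ext; simp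
  simp only [wExp, yExp, expo_x, expo_y, expo_w, pow_ite, pow_zero, pow_one, Finset.prod_const_one,
    mul_one, Finset.prod_ite, h, h', Finset.prod_pow]
  ring

theorem extDeg_koszulExp (i j : Fin n) : extDeg (koszulExp a i j) = 1 := by
  simp [extDeg, koszulExp]

theorem extDeg_wExp (s : Finset (Fin n)) : extDeg (wExp a b s) = s.card := by
  simp [extDeg, wExp]

theorem extDeg_yExp (s : Finset (Fin n)) : extDeg (yExp a b s) = s.card := by
  simp [extDeg, yExp]

theorem xDeg_koszulExp (i j : Fin n) :
    xDeg a b (koszulExp a i j) = xDeg a b (koszulExp a j i) := by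
  ext l
  simp only [xDeg_apply, koszulExp, expo_x, expo_y, expo_w]
  split_ifs <;> ring

theorem xDeg_wExp (s : Finset (Fin n)) : xDeg a b (wExp a b s) = xDeg a b (yExp a b s) := by
  ext l
  simp only [xDeg_apply, wExp, yExp, expo_x, expo_y, expo_w, mul_comm b]
  split_ifs <;> omega

theorem koszul_mem (i j : Fin n) : koszul k a i j ∈ reesIdeal k n a b := by
  rw [koszul_eq]
  exact monomial_sub_monomial_mem (by simp only [extDeg_koszulExp]) (xDeg_koszulExp i j)

theorem sylvBinomial_mem (s : Finset (Fin n)) : sylvBinomial k a b s ∈ reesIdeal k n a b := by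
  rw [sylvBinomial_eq]
  exact monomial_sub_monomial_mem (by rw [extDeg_wExp, extDeg_yExp]) (xDeg_wExp s)

end Binomials

/-! ### Generation of the Rees ideal -/

section Generation

variable {k : Type*} [Field k] {n a b : ℕ}

theorem monomial_sub_mem_of_le {J : Ideal (S k n)} {p q m : RVar n →₀ ℕ}
    (h : (monomial p 1 - monomial q 1 : S k n) ∈ J) (hp : p ≤ m) :
    (monomial m 1 - monomial (m - p + q) 1 : S k n) ∈ J := by
  have := J.mul_mem_left (monomial (m - p) 1) h
  rwa [mul_sub, monomial_mul, monomial_mul, mul_one, tsub_add_cancel_of_le hp] at this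

theorem extDeg_sub_add {p q m : RVar n →₀ ℕ} (h : extDeg p = extDeg q) (hp : p ≤ m) :
    extDeg (m - p + q) = extDeg m := by
  rw [extDeg_add, ← h, ← extDeg_add, tsub_add_cancel_of_le hp]

theorem xDeg_sub_add {p q m : RVar n →₀ ℕ} (h : xDeg a b p = xDeg a b q) (hp : p ≤ m) :
    xDeg a b (m - p + q) = xDeg a b m := by
  rw [xDeg_add, ← h, ← xDeg_add, tsub_add_cancel_of_le hp]

/-- The differences of monomials of external degree `d` in the same fibre lie in `J`. -/
def FibreMem (a b : ℕ) (J : Ideal (S k n)) (d : ℕ) : Prop :=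
  ∀ m m' : RVar n →₀ ℕ, extDeg m = d → extDeg m' = d → xDeg a b m = xDeg a b m' →
    (monomial m 1 - monomial m' 1 : S k n) ∈ J

/-- A variable of external degree one that divides both monomials can be cancelled. -/
theorem FibreMem.of_common {J : Ideal (S k n)} {d : ℕ} (hJ : FibreMem a b J d)
    {m m' : RVar n →₀ ℕ} (h : extDeg m = d + 1) (h' : extDeg m' = d + 1)
    (hx : xDeg a b m = xDeg a b m') (v : RVar n) (hv : extDeg (Finsupp.single v 1) = 1)
    (hm : m v ≠ 0) (hm' : m' v ≠ 0) : (monomial m 1 - monomial m' 1 : S k n) ∈ J := by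
  have e : Finsupp.single v 1 + (m - Finsupp.single v 1) = m :=
    add_tsub_cancel_of_le (Finsupp.single_le_iff.2 (Nat.one_le_iff_ne_zero.2 hm))
  have e' : Finsupp.single v 1 + (m' - Finsupp.single v 1) = m' :=
    add_tsub_cancel_of_le (Finsupp.single_le_iff.2 (Nat.one_le_iff_ne_zero.2 hm'))
  rw [← e, extDeg_add, hv] at h
  rw [← e', extDeg_add, hv] at h'
  rw [← e, ← e', xDeg_add, xDeg_add] at hx
  have := J.mul_mem_left (monomial (Finsupp.single v 1) 1)
    (hJ _ _ (by omega) (by omega) (add_left_cancel hx))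
  rwa [mul_sub, monomial_mul, monomial_mul, mul_one, e, e'] at this

theorem extDeg_single_y (i : Fin n) : extDeg (Finsupp.single (RVar.y i) 1) = 1 := by
  simp [extDeg, Finsupp.single_apply]

theorem extDeg_single_w : extDeg (Finsupp.single (RVar.w : RVar n) 1) = 1 := by
  simp [extDeg]

/-- If both monomials are divisible by some `y_i`, then a Koszul syzygy produces a common one. -/
theorem FibreMem.of_y {J : Ideal (S k n)} (hK : ∀ i j : Fin n, koszul k a i j ∈ J) {d : ℕ}
    (hJ : FibreMem a b J d) {m m' : RVar n →₀ ℕ} (h : extDeg m = d + 1) (h' : extDeg m' = d + 1)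
    (hx : xDeg a b m = xDeg a b m') {i j : Fin n} (hi : m (RVar.y i) ≠ 0)
    (hj : m' (RVar.y j) ≠ 0) : (monomial m 1 - monomial m' 1 : S k n) ∈ J := by
  -- By symmetry, `m` may be taken to have the larger exponent of `w`.
  wlog hw : m' RVar.w ≤ m RVar.w generalizing m m' i j
  · rw [← neg_sub]
    exact J.neg_mem (this h' h hx.symm hj hi (le_of_not_ge hw))
  by_cases hij : m' (RVar.y i) = 0
  · have hxi := DFunLike.congr_fun hx i
    simp only [xDeg_apply, hij] at hxi
    have ha : a ≤ m' (RVar.x i) := by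
      have h1 : a * 1 ≤ a * m (RVar.y i) := Nat.mul_le_mul_left a (Nat.pos_of_ne_zero hi)
      have h2 : b * m' RVar.w ≤ b * m RVar.w := Nat.mul_le_mul_left b hw
      omega
    have hle : koszulExp a i j ≤ m' := by
      refine le_expo (fun l => ?_) (fun l => ?_) (Nat.zero_le _)
      · simp only [koszulExp, expo_x]; split_ifs with hl
        · rwa [hl]
        · exact Nat.zero_le _
      · simp only [koszulExp, expo_y]; split_ifs with hl
        · rw [hl]; omega
        · exact Nat.zero_le _
    have h1 := monomial_sub_mem_of_le (koszul_eq (k := k) (a := a) i j ▸ hK i j) hle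
    have h2 : (monomial m 1 - monomial (m' - koszulExp a i j + koszulExp a j i) 1 : S k n) ∈ J := by
      refine hJ.of_common h ?_ ?_ (RVar.y i) (extDeg_single_y i) hi ?_
      · rw [extDeg_sub_add (by simp only [extDeg_koszulExp]) hle, h']
      · rw [xDeg_sub_add (xDeg_koszulExp i j) hle, hx]
      · simp [koszulExp]
    have := J.sub_mem h2 h1
    rwa [sub_sub_sub_cancel_right] at this
  · exact hJ.of_common h h' hx (RVar.y i) (extDeg_single_y i) hi hij

/-- The remaining case: a power of `w` against a monomial free of `w`. -/
theorem FibreMem.of_pure {J : Ideal (S k n)} (hK : ∀ i j : Fin n, koszul k a i j ∈ J) {r : ℕ}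
    (hrb : r * b < a) (hr : a ≤ (r + 1) * b ∨ r + 1 = n) {s₀ : Finset (Fin n)} (hs₀ : s₀.card = r + 1)
    (hJs₀ : sylvBinomial k a b s₀ ∈ J)
    (hJs : ∀ s : Finset (Fin n), 1 ≤ s.card → s.card ≤ r → sylvBinomial k a b s ∈ J) {d : ℕ}
    (hJ : FibreMem a b J d) {m m' : RVar n →₀ ℕ} (h : extDeg m = d + 1) (h' : extDeg m' = d + 1)
    (hx : xDeg a b m = xDeg a b m') (hm : ∀ i, m (RVar.y i) = 0) (hm' : m' RVar.w = 0) :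
    (monomial m 1 - monomial m' 1 : S k n) ∈ J := by
  have hmw : m RVar.w = d + 1 := by simpa [extDeg, hm] using h
  have hsum : ∑ i, m' (RVar.y i) = d + 1 := by simpa [extDeg, hm'] using h'
  obtain ⟨i₀, hi₀⟩ : ∃ i, m' (RVar.y i) ≠ 0 := by
    by_contra! hc
    simp [hc] at hsum
  by_cases hd : a ≤ (r + 1) * b ∧ r + 1 ≤ d + 1
  · -- `w ^ (r + 1)` is a monomial of `H_{s₀}` and divides `m`.
    have hle : wExp a b s₀ ≤ m := by
      refine le_expo (fun l => ?_) (fun l => ?_) ?_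
      · simp [wExp, hs₀, Nat.sub_eq_zero_of_le hd.1]
      · simp [wExp]
      · simp only [wExp, expo_w]; omega
    have h1 := monomial_sub_mem_of_le (sylvBinomial_eq (k := k) (a := a) (b := b) s₀ ▸ hJs₀) hle
    obtain ⟨i, hi⟩ : s₀.Nonempty := Finset.card_pos.1 (by omega)
    have h2 : (monomial (m - wExp a b s₀ + yExp a b s₀) 1 - monomial m' 1 : S k n) ∈ J := by
      refine hJ.of_y hK ?_ h' ?_ (i := i) ?_ hi₀
      · rw [extDeg_sub_add (by rw [extDeg_wExp, extDeg_yExp]) hle, h]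
      · rw [xDeg_sub_add (xDeg_wExp s₀) hle, hx]
      · simp [yExp, hi]
    have := J.add_mem h1 h2
    rwa [sub_add_sub_cancel] at this
  · -- Otherwise the set `s` of all `i` such that `y_i` divides `m'` is among those allowed, and
    -- the monomial of `H_s` free of `w` divides `m'`.
    set s : Finset (Fin n) := Finset.univ.filter fun i => m' (RVar.y i) ≠ 0 with hs
    have hs1 : 1 ≤ s.card := Finset.card_pos.2 ⟨i₀, by simpa [hs] using hi₀⟩
    have hsd : s.card ≤ d + 1 := by
      rw [← hsum, Finset.card_eq_sum_ones]
      refine (Finset.sum_le_sum (g := fun i => m' (RVar.y i)) fun i hi => ?_).trans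
        (Finset.sum_le_sum_of_subset (Finset.subset_univ s))
      have := (Finset.mem_filter.1 hi).2
      omega
    have hsn : s.card ≤ n := by simpa using s.card_le_univ
    have hsa : s.card * b ≤ a ∧ sylvBinomial k a b s ∈ J := by
      by_cases hsr : s.card ≤ r
      · exact ⟨(Nat.mul_le_mul_right b hsr).trans hrb.le, hJs s hs1 hsr⟩
      · have har : (r + 1) * b < a := by
          by_contra! hc
          exact hd ⟨hc, by omega⟩
        have hrn : r + 1 = n := hr.resolve_left (not_le.2 har)
        have hs' : s = s₀ := by
          rw [(Finset.card_eq_iff_eq_univ s).1 (by rw [Fintype.card_fin]; omega),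
            (Finset.card_eq_iff_eq_univ s₀).1 (by rw [Fintype.card_fin]; omega)]
        exact ⟨by rw [hs', hs₀]; exact har.le, hs' ▸ hJs₀⟩
    have hle : yExp a b s ≤ m' := by
      refine le_expo (fun l => ?_) (fun l => ?_) (Nat.zero_le _)
      · simp only [yExp, expo_x]; split_ifs with hl
        · omega
        · have hl' : m' (RVar.y l) = 0 := by simpa [hs] using hl
          have hxl := DFunLike.congr_fun hx l
          simp only [xDeg_apply, hl', hm', hmw] at hxl
          have := Nat.mul_le_mul_left b hsd
          rw [mul_comm]
          omega
      · simp only [yExp, expo_y]; split_ifs with hl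
        · have : m' (RVar.y l) ≠ 0 := by simpa [hs] using hl
          omega
        · exact Nat.zero_le _
    have h1 := monomial_sub_mem_of_le (q := wExp a b s)
      (by rw [← neg_sub, ← sylvBinomial_eq (k := k)]; exact J.neg_mem hsa.2) hle
    have h2 : (monomial m 1 - monomial (m' - yExp a b s + wExp a b s) 1 : S k n) ∈ J := by
      refine hJ.of_common h ?_ ?_ RVar.w extDeg_single_w (by omega) ?_
      · rw [extDeg_sub_add (by rw [extDeg_wExp, extDeg_yExp]) hle, h']
      · rw [xDeg_sub_add (xDeg_wExp s).symm hle, hx]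
      · simp only [wExp, Finsupp.add_apply, expo_w]; omega
    have := J.sub_mem h2 h1
    rwa [sub_sub_sub_cancel_right] at this

/-- An ideal contains the Rees ideal if it contains the Koszul syzygies, the `H_s` with
`1 ≤ |s| ≤ r` and one `H_{s₀}` with `|s₀| = r + 1`. -/
theorem reesIdeal_le_of_generators {J : Ideal (S k n)} (hK : ∀ i j : Fin n, koszul k a i j ∈ J)
    {r : ℕ} (hrb : r * b < a) (hr : a ≤ (r + 1) * b ∨ r + 1 = n) {s₀ : Finset (Fin n)}
    (hs₀ : s₀.card = r + 1) (hJs₀ : sylvBinomial k a b s₀ ∈ J)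
    (hJs : ∀ s : Finset (Fin n), 1 ≤ s.card → s.card ≤ r → sylvBinomial k a b s ∈ J) :
    reesIdeal k n a b ≤ J := by
  have key : ∀ d, FibreMem a b J d := by
    intro d
    induction d with
    | zero =>
      intro m m' h h' hx
      simp only [extDeg, Nat.add_eq_zero_iff, Finset.sum_eq_zero_iff, Finset.mem_univ,
        true_implies] at h h'
      have : m = m' := by
        refine ext_expo (fun i => ?_) (fun i => by rw [h.1, h'.1]) (by rw [h.2, h'.2])
        have := DFunLike.congr_fun hx i
        simpa [h.1 i, h'.1 i, h.2, h'.2] using this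
      rw [this, sub_self]
      exact J.zero_mem
    | succ d ih =>
      intro m m' h h' hx
      by_cases hw : m RVar.w ≠ 0 ∧ m' RVar.w ≠ 0
      · exact ih.of_common h h' hx RVar.w extDeg_single_w hw.1 hw.2
      by_cases hm : ∀ i, m (RVar.y i) = 0
      · have : m RVar.w ≠ 0 := by
          intro h0
          simp [extDeg, hm, h0] at h
        exact ih.of_pure hK hrb hr hs₀ hJs₀ hJs h h' hx hm (by tauto)
      by_cases hm' : ∀ i, m' (RVar.y i) = 0
      · have : m' RVar.w ≠ 0 := by
          intro h0
          simp [extDeg, hm', h0] at h'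
        rw [← neg_sub]
        exact J.neg_mem (ih.of_pure hK hrb hr hs₀ hJs₀ hJs h' h hx.symm hm' (by tauto))
      push Not at hm hm'
      obtain ⟨i, hi⟩ := hm
      obtain ⟨j, hj⟩ := hm'
      exact ih.of_y hK h h' hx hi hj
  refine reesIdeal_le_of_monomials fun m m' h hx => key _ m m' h rfl hx

theorem span_generators {r : ℕ} (hrb : r * b < a) (hr : a ≤ (r + 1) * b ∨ r + 1 = n)
    {s₀ : Finset (Fin n)} (hs₀ : s₀.card = r + 1) :
    Ideal.span (generators k a b r s₀) = reesIdeal k n a b := by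
  refine le_antisymm (Ideal.span_le.2 ?_) (reesIdeal_le_of_generators (fun i j => ?_) hrb hr hs₀
    (Ideal.subset_span (Or.inr rfl))
    fun s h1 h2 => Ideal.subset_span (Or.inl (Or.inr ⟨s, h1, h2, rfl⟩)))
  · rintro f ((⟨i, j, -, rfl⟩ | ⟨s, -, -, rfl⟩) | rfl)
    exacts [koszul_mem i j, sylvBinomial_mem s, sylvBinomial_mem s₀]
  · rcases lt_trichotomy i j with h | rfl | h
    · exact Ideal.subset_span (Or.inl (Or.inl ⟨i, j, h, rfl⟩))
    · rw [koszul_eq, sub_self]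
      exact Ideal.zero_mem _
    · have := neg_mem (Ideal.subset_span (α := S k n) (s := generators k a b r s₀)
        (Or.inl (Or.inl ⟨j, i, h, rfl⟩)))
      rwa [koszul_eq, neg_sub, ← koszul_eq] at this

end Generation

/-! ### Isolated monomials and the minimality of the generators -/

section Isolated

variable {k : Type*} [Field k] {n a b : ℕ}

/-- The exponent `m₀` is isolated if no other monomial in its fibre has a common variable
with it. -/
def IsIsolated (a b : ℕ) (m₀ : RVar n →₀ ℕ) : Prop :=
  ∀ (v : RVar n) (m : RVar n →₀ ℕ), m₀ v ≠ 0 → m v ≠ 0 → extDeg m = extDeg m₀ →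
    xDeg a b m = xDeg a b m₀ → m = m₀

theorem coeff_eq_zero_of_unique {f : S k n} (hf : f ∈ reesIdeal k n a b) {m₀ : RVar n →₀ ℕ}
    (h : ∀ m, extDeg m = extDeg m₀ → xDeg a b m = xDeg a b m₀ → m = m₀) : coeff m₀ f = 0 := by
  classical
  rw [← sum_fibre_eq_zero hf (extDeg m₀) (xDeg a b m₀)]
  by_cases hm : m₀ ∈ f.support
  · have : f.support.filter (fun m => (extDeg m, xDeg a b m) = (extDeg m₀, xDeg a b m₀))
        = {m₀} := by
      ext m
      simp only [Finset.mem_filter, Prod.mk.injEq, Finset.mem_singleton]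
      exact ⟨fun hc => h m hc.2.1 hc.2.2, by rintro rfl; exact ⟨hm, rfl, rfl⟩⟩
    rw [this, Finset.sum_singleton]
  · rw [notMem_support_iff.1 hm]
    refine (Finset.sum_eq_zero fun m hc => ?_).symm
    rw [Finset.mem_filter, Prod.mk.injEq] at hc
    exact absurd (h m hc.2.1 hc.2.2 ▸ hc.1) hm

/-- The coefficient at an isolated monomial is a functional on the Rees ideal that vanishes on
its product with the irrelevant maximal ideal of `S`. -/
theorem IsIsolated.coeff_mul {m₀ : RVar n →₀ ℕ} (h₀ : IsIsolated a b m₀) (p : S k n) {f : S k n}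
    (hf : f ∈ reesIdeal k n a b) : coeff m₀ (p * f) = constantCoeff p * coeff m₀ f := by
  classical
  induction p using MvPolynomial.induction_on with
  | C c => simp
  | add p q hp hq => rw [add_mul, coeff_add, hp, hq, map_add, add_mul]
  | mul_X p v _ =>
    rw [map_mul, constantCoeff_X, mul_zero, zero_mul, mul_right_comm, coeff_mul_X']
    split_ifs with hv
    · have hv0 : m₀ v ≠ 0 := by simpa using hv
      have e : m₀ - Finsupp.single v 1 + Finsupp.single v 1 = m₀ :=
        tsub_add_cancel_of_le (Finsupp.single_le_iff.2 (Nat.one_le_iff_ne_zero.2 hv0))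
      refine coeff_eq_zero_of_unique ((reesIdeal k n a b).mul_mem_left p hf) fun m h1 h2 => ?_
      have := h₀ v (m + Finsupp.single v 1) hv0 (by simp)
        (by rw [extDeg_add, h1, ← extDeg_add, e]) (by rw [xDeg_add, h2, ← xDeg_add, e])
      exact add_right_cancel (this.trans e.symm)
    · rfl

theorem isIsolated_wExp (hb : 0 < b) {s : Finset (Fin n)} (hs : s.card * b < a + b) :
    IsIsolated a b (wExp a b s) := by
  intro v m hv hmv h1 h2
  have hx : ∀ i, m (RVar.x i) + a * m (RVar.y i) + b * m RVar.w
      = (if i ∈ s then a - s.card * b else 0) + s.card * b := by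
    intro i
    have := DFunLike.congr_fun h2 i
    simp only [xDeg_apply, wExp, expo_x, expo_y, expo_w] at this
    rw [this]; ring
  rw [extDeg_wExp] at h1
  suffices hy : ∀ i, m (RVar.y i) = 0 by
    have hw : m RVar.w = s.card := by simpa [extDeg, hy] using h1
    refine ext_expo (fun i => ?_) (fun i => by rw [hy]; rfl) hw
    have := hx i
    rw [hy, hw, mul_comm b] at this
    simp only [wExp, expo_x]
    omega
  by_cases hw : m RVar.w = 0
  · rcases v with i | i | _
    · -- The monomials share `x_i`. The exponents of the `y_j` in `m` are at most one and vanish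
      -- for `j = i` and for `j` outside of `s`, so that their sum is less than `|s|`.
      exfalso
      have hi : i ∈ s := by
        by_contra hi
        exact hv (by simp [wExp, hi])
      have hi' : s.card * b < a := by
        simp only [wExp, expo_x, hi, if_true] at hv
        omega
      have hle : ∀ j, m (RVar.y j) ≤ if j ∈ s.erase i then 1 else 0 := by
        intro j
        have hj := hx j
        split_ifs with hji
        · rw [if_pos (Finset.mem_of_mem_erase hji)] at hj
          by_contra! hc
          have := Nat.mul_le_mul_left a hc
          omega
        · by_contra! hc
          have := Nat.mul_le_mul_left a hc
          by_cases hjs : j ∈ s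
          · obtain rfl : j = i := by
              by_contra hne
              exact hji (Finset.mem_erase.2 ⟨hne, hjs⟩)
            rw [if_pos hjs] at hj
            omega
          · rw [if_neg hjs] at hj
            omega
      have hsum : s.card ≤ (s.erase i).card := by
        have := Finset.sum_le_sum fun j (_ : j ∈ Finset.univ) => hle j
        simp only [extDeg, hw, add_zero] at h1
        rwa [h1, Finset.sum_ite_mem, Finset.univ_inter, ← Finset.card_eq_sum_ones] at this
      exact absurd hsum (not_le.2 (Finset.card_erase_lt_of_mem hi))
    · exact absurd rfl hv
    · exact absurd hw hmv
  · intro i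
    by_contra hc
    have h3 := Nat.mul_le_mul_left a (Nat.one_le_iff_ne_zero.2 hc)
    have h4 := Nat.mul_le_mul_left b (Nat.one_le_iff_ne_zero.2 hw)
    have h5 := hx i
    split_ifs at h5 <;> omega

theorem isIsolated_koszulExp (hb : 0 < b) (hn : 3 ≤ n) {i j : Fin n} (hij : i ≠ j) (ha : 0 < a) :
    IsIsolated a b (koszulExp a i j) := by
  intro v m hv hmv h1 h2
  have hx : ∀ l, m (RVar.x l) + a * m (RVar.y l) + b * m RVar.w
      = (if l = i then a else 0) + (if l = j then a else 0) := by
    intro l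
    have := DFunLike.congr_fun h2 l
    simp only [xDeg_apply, koszulExp, expo_x, expo_y, expo_w] at this
    rw [this]
    split_ifs <;> simp
  obtain ⟨l, hl⟩ : ∃ l, l ∉ ({i, j} : Finset (Fin n)) := by
    by_contra! hc
    have h3 := Finset.card_le_card (fun l _ => hc l : Finset.univ ⊆ ({i, j} : Finset (Fin n)))
    have h4 := Finset.card_le_two (a := i) (b := j)
    rw [Finset.card_univ, Fintype.card_fin] at h3
    omega
  -- The variable `x_l` does not occur in the image, whereas it occurs in the image of `w`.
  have hw : m RVar.w = 0 := by
    have h3 := hx l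
    simp only [Finset.mem_insert, Finset.mem_singleton, not_or] at hl
    rw [if_neg hl.1, if_neg hl.2] at h3
    have : b * m RVar.w = 0 := by omega
    exact (Nat.mul_eq_zero.1 this).resolve_left hb.ne'
  have hsum : ∑ l, m (RVar.y l) = 1 := by
    simpa [extDeg, hw, koszulExp] using h1
  have hyj : m (RVar.y j) ≠ 0 := by
    rcases v with l | l | _
    · obtain rfl : l = i := by
        by_contra hne
        exact hv (by simp [koszulExp, hne])
      intro h0
      have h3 : ∀ p, m (RVar.y p) = 0 := by
        intro p
        by_contra hc
        have h4 := Nat.mul_le_mul_left a (Nat.one_le_iff_ne_zero.2 hc)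
        have h5 := hx p
        have h6 : p ≠ j := by rintro rfl; exact hc h0
        by_cases hp : p = l
        · subst hp
          rw [if_pos rfl, if_neg hij] at h5
          omega
        · rw [if_neg hp, if_neg h6] at h5
          omega
      simp [h3] at hsum
    · obtain rfl : l = j := by
        by_contra hne
        exact hv (by simp [koszulExp, hne])
      exact hmv
    · exact absurd rfl hv
  have hy : ∀ l, m (RVar.y l) = if l = j then 1 else 0 := by
    rw [← Finset.add_sum_erase _ _ (Finset.mem_univ j)] at hsum
    intro l
    split_ifs with hl
    · rw [hl]; omega
    · have h3 : ∑ p ∈ Finset.univ.erase j, m (RVar.y p) = 0 := by omega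
      exact Finset.sum_eq_zero_iff.1 h3 l (Finset.mem_erase.2 ⟨hl, Finset.mem_univ l⟩)
  refine ext_expo (fun l => ?_) hy hw
  have h3 := hx l
  rw [hy, hw] at h3
  simp only [koszulExp, expo_x]
  split_ifs at h3 ⊢ <;> omega

end Isolated

section Index

variable {k : Type*} [Field k] {n a b r : ℕ} {s₀ : Finset (Fin n)}

/-- The form `K_{ij}` or `H_s`. -/
def indexForm (k : Type*) [Field k] (a b : ℕ) : (Fin n × Fin n) ⊕ Finset (Fin n) → S k n
  | Sum.inl p => koszul k a p.1 p.2
  | Sum.inr s => sylvBinomial k a b s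

/-- The exponent of one monomial of `K_{ij}` or `H_s`: of `x_i^a y_j`, or of the one divisible by
`w`. -/
def indexExp (a b : ℕ) : (Fin n × Fin n) ⊕ Finset (Fin n) → RVar n →₀ ℕ
  | Sum.inl p => koszulExp a p.1 p.2
  | Sum.inr s => wExp a b s

/-- The exponent of the other monomial of `K_{ij}` or `H_s`. -/
def indexExp' (a b : ℕ) : (Fin n × Fin n) ⊕ Finset (Fin n) → RVar n →₀ ℕ
  | Sum.inl p => koszulExp a p.2 p.1
  | Sum.inr s => yExp a b s

/-- The indices of the elements of `generators k a b r s₀`. -/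
def genIndex (r : ℕ) (s₀ : Finset (Fin n)) : Finset ((Fin n × Fin n) ⊕ Finset (Fin n)) :=
  (Finset.univ.filter fun p : Fin n × Fin n => p.1 < p.2).disjSum
    (insert s₀ (Finset.univ.filter fun s : Finset (Fin n) => 1 ≤ s.card ∧ s.card ≤ r))

@[simp] theorem inl_mem_genIndex {p : Fin n × Fin n} :
    Sum.inl p ∈ genIndex r s₀ ↔ p.1 < p.2 := by
  simp [genIndex]

@[simp] theorem inr_mem_genIndex {s : Finset (Fin n)} :
    Sum.inr s ∈ genIndex r s₀ ↔ s = s₀ ∨ 1 ≤ s.card ∧ s.card ≤ r := by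
  simp [genIndex]

theorem indexForm_eq (p : (Fin n × Fin n) ⊕ Finset (Fin n)) :
    indexForm k a b p = monomial (indexExp a b p) 1 - monomial (indexExp' a b p) 1 := by
  rcases p with p | s
  exacts [koszul_eq _ _, sylvBinomial_eq _]

theorem indexForm_mem (p : (Fin n × Fin n) ⊕ Finset (Fin n)) :
    indexForm k a b p ∈ reesIdeal k n a b := by
  rcases p with p | s
  exacts [koszul_mem _ _, sylvBinomial_mem _]

theorem generators_eq_image : generators k a b r s₀ = indexForm k a b '' genIndex r s₀ := by
  ext f
  constructor
  · rintro ((⟨i, j, h, rfl⟩ | ⟨s, h1, h2, rfl⟩) | rfl)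
    · exact ⟨Sum.inl (i, j), by simpa using h, rfl⟩
    · exact ⟨Sum.inr s, inr_mem_genIndex.2 (Or.inr ⟨h1, h2⟩), rfl⟩
    · exact ⟨Sum.inr s₀, by simp, rfl⟩
  · rintro ⟨p | s, h, rfl⟩
    · exact Or.inl (Or.inl ⟨p.1, p.2, by simpa using h, rfl⟩)
    · rw [Finset.mem_coe, inr_mem_genIndex] at h
      rcases h with rfl | h
      exacts [Or.inr rfl, Or.inl (Or.inr ⟨s, h.1, h.2, rfl⟩)]

theorem koszulExp_injective (ha : 0 < a) {i j i' j' : Fin n}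
    (h : koszulExp a i j = koszulExp a i' j') : i = i' ∧ j = j' := by
  have h1 := DFunLike.congr_fun h (RVar.x i)
  have h2 := DFunLike.congr_fun h (RVar.y j)
  simp only [koszulExp, expo_x, expo_y, if_true] at h1 h2
  constructor
  · by_contra hc
    rw [if_neg hc] at h1
    omega
  · by_contra hc
    rw [if_neg hc] at h2
    omega

theorem one_le_card_of_mem_genIndex (hs₀ : s₀.card = r + 1) {s : Finset (Fin n)}
    (hs : Sum.inr s ∈ genIndex r s₀) : 1 ≤ s.card := by
  rcases inr_mem_genIndex.1 hs with rfl | hs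
  · omega
  · exact hs.1

theorem indexExp_injOn (hrb : r * b < a) (hs₀ : s₀.card = r + 1) :
    Set.InjOn (indexExp a b) (genIndex r s₀ : Set ((Fin n × Fin n) ⊕ Finset (Fin n))) := by
  rintro (⟨i, j⟩ | s) hp (⟨i', j'⟩ | s') hq h
  · obtain ⟨rfl, rfl⟩ := koszulExp_injective (by omega) h
    rfl
  · have h1 := DFunLike.congr_fun h RVar.w
    have h2 := one_le_card_of_mem_genIndex hs₀ hq
    simp only [indexExp, koszulExp, wExp, expo_w] at h1
    omega
  · have h1 := DFunLike.congr_fun h RVar.w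
    have h2 := one_le_card_of_mem_genIndex hs₀ hp
    simp only [indexExp, koszulExp, wExp, expo_w] at h1
    omega
  · have hc : s.card = s'.card := DFunLike.congr_fun h RVar.w
    rw [Finset.mem_coe, inr_mem_genIndex] at hp hq
    by_cases hsr : s.card ≤ r
    · have hlt : s.card * b < a := (Nat.mul_le_mul_right b hsr).trans_lt hrb
      refine congrArg Sum.inr (Finset.ext fun i => ?_)
      have h1 := DFunLike.congr_fun h (RVar.x i)
      simp only [indexExp, wExp, expo_x, ← hc] at h1
      by_cases h2 : i ∈ s <;> by_cases h3 : i ∈ s' <;> simp only [h2, h3, if_true, if_false] at h1 ⊢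
        <;> omega
    · rw [hp.resolve_right (by omega), hq.resolve_right (by omega)]

theorem indexExp_ne (hb : 0 < b) (hab : b < a) (hs₀ : s₀.card = r + 1)
    {p q : (Fin n × Fin n) ⊕ Finset (Fin n)} (hp : p ∈ genIndex r s₀) (hq : q ∈ genIndex r s₀) :
    indexExp a b p ≠ indexExp' a b q := by
  intro h
  rcases p with ⟨i, j⟩ | s
  · rcases q with ⟨i', j'⟩ | s'
    · obtain ⟨rfl, rfl⟩ := koszulExp_injective (by omega) h
      rw [inl_mem_genIndex] at hp hq
      exact absurd hp hq.asymm
    · have hs' : s' = {j} := by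
        ext l
        have := DFunLike.congr_fun h (RVar.y l)
        simp only [indexExp, indexExp', koszulExp, yExp, expo_y] at this
        rw [Finset.mem_singleton]
        split_ifs at this <;> simp_all
      have h1 := DFunLike.congr_fun h (RVar.x i)
      have h2 : i ≠ j := (inl_mem_genIndex.1 hp).ne
      simp only [indexExp, indexExp', koszulExp, yExp, expo_x, if_true, hs', Finset.mem_singleton,
        h2, if_false, Finset.card_singleton, one_mul] at h1
      omega
  · have h1 := DFunLike.congr_fun h RVar.w
    have h2 := one_le_card_of_mem_genIndex hs₀ hp
    rcases q with ⟨i', j'⟩ | s' <;>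
      simp only [indexExp, indexExp', koszulExp, wExp, yExp, expo_w] at h1 <;> omega

theorem coeff_indexForm (hb : 0 < b) (hab : b < a) (hrb : r * b < a) (hs₀ : s₀.card = r + 1)
    {p q : (Fin n × Fin n) ⊕ Finset (Fin n)} (hp : p ∈ genIndex r s₀) (hq : q ∈ genIndex r s₀) :
    coeff (indexExp a b p) (indexForm k a b q) = if p = q then 1 else 0 := by
  classical
  rw [indexForm_eq, coeff_sub, coeff_monomial, coeff_monomial,
    if_neg (indexExp_ne hb hab hs₀ hp hq).symm, sub_zero]
  exact if_congr ⟨fun h => (indexExp_injOn hrb hs₀ hq hp h).symm, fun h => by rw [h]⟩ rfl rfl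

theorem indexForm_injOn (hb : 0 < b) (hab : b < a) (hrb : r * b < a) (hs₀ : s₀.card = r + 1) :
    Set.InjOn (indexForm k a b) (genIndex r s₀ : Set ((Fin n × Fin n) ⊕ Finset (Fin n))) := by
  intro p hp q hq h
  have h1 := coeff_indexForm (k := k) hb hab hrb hs₀ hp hp
  rw [h, coeff_indexForm hb hab hrb hs₀ hp hq, if_pos rfl] at h1
  by_contra hc
  simp [hc] at h1

theorem card_filter_lt (n : ℕ) :
    (Finset.univ.filter fun p : Fin n × Fin n => p.1 < p.2).card = n.choose 2 := by
  rw [Finset.card_filter, ← Finset.univ_product_univ, Finset.sum_product_right]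
  have h : ∀ j : Fin n, (Finset.univ.filter fun i => i < j).card = j := by
    intro j
    rw [← Fin.card_Iio]
    congr 1
    ext i
    simp
  simp_rw [← Finset.card_filter, h]
  rw [Fin.sum_univ_eq_sum_range (fun i => i), Finset.sum_range_id, Nat.choose_two_right]

theorem card_genIndex (hs₀ : s₀.card = r + 1) :
    (genIndex r s₀).card = n.choose 2 + (∑ δ ∈ Finset.Icc 1 r, n.choose δ) + 1 := by
  rw [genIndex, Finset.card_disjSum, card_filter_lt, Finset.card_insert_of_notMem (by simp [hs₀]),
    add_assoc]
  congr 2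
  rw [Finset.card_eq_sum_card_fiberwise (f := Finset.card) (t := Finset.Icc 1 r)
    (fun s hs => by simpa using hs)]
  refine Finset.sum_congr rfl fun δ hδ => ?_
  rw [Finset.mem_Icc] at hδ
  have h := Finset.card_powersetCard δ (Finset.univ : Finset (Fin n))
  rw [Finset.card_univ, Fintype.card_fin] at h
  rw [← h]
  congr 1
  ext s
  simp only [Finset.mem_filter, Finset.mem_univ, true_and, Finset.mem_powersetCard,
    Finset.subset_univ]
  omega

theorem ncard_generators (hb : 0 < b) (hab : b < a) (hrb : r * b < a) (hs₀ : s₀.card = r + 1) :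
    (generators k a b r s₀).ncard = n.choose 2 + (∑ δ ∈ Finset.Icc 1 r, n.choose δ) + 1 := by
  rw [generators_eq_image, (indexForm_injOn hb hab hrb hs₀).ncard_image, Set.ncard_coe_finset,
    card_genIndex hs₀]

theorem ncard_koszulForms (ha : 0 < a) : (koszulForms k n a).ncard = n.choose 2 := by
  classical
  have h : koszulForms k n a = (fun p : Fin n × Fin n => koszul k a p.1 p.2) ''
      (Finset.univ.filter fun p : Fin n × Fin n => p.1 < p.2 : Finset _) := by
    ext f
    constructor
    · rintro ⟨i, j, h, rfl⟩
      exact ⟨(i, j), by simpa using h, rfl⟩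
    · rintro ⟨p, h, rfl⟩
      exact ⟨p.1, p.2, by simpa using h, rfl⟩
  rw [h, Set.InjOn.ncard_image, Set.ncard_coe_finset, card_filter_lt]
  rintro ⟨i, j⟩ hp ⟨i', j'⟩ hq hf
  simp only [Finset.coe_filter, Finset.mem_univ, true_and, Set.mem_ofPred_eq] at hp hq hf
  have h1 := congrArg (coeff (koszulExp a i j)) hf
  simp only [koszul_eq, coeff_sub, coeff_monomial] at h1
  rw [if_pos trivial, if_neg fun h => hp.ne' (koszulExp_injective ha h).1,
    if_neg (fun h : koszulExp a j' i' = koszulExp a i j => ?_), sub_zero, sub_zero] at h1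
  · have h2 : koszulExp a i' j' = koszulExp a i j := by
      by_contra hc
      simp [hc] at h1
    obtain ⟨rfl, rfl⟩ := koszulExp_injective ha h2
    rfl
  · obtain ⟨rfl, rfl⟩ := koszulExp_injective ha h
    exact hp.asymm hq

theorem isIsolated_indexExp (hn : n ≠ 2) (hb : 0 < b) (hrb : r * b < a)
    (hs₀ : s₀.card = r + 1) {p : (Fin n × Fin n) ⊕ Finset (Fin n)} (hp : p ∈ genIndex r s₀) :
    IsIsolated a b (indexExp a b p) := by
  rcases p with ⟨i, j⟩ | s
  · have hij : i < j := by simpa using hp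
    have := j.isLt
    have : i.val < j.val := hij
    exact isIsolated_koszulExp hb (by omega) hij.ne (by omega)
  · refine isIsolated_wExp hb ?_
    have h1 : s.card ≤ r + 1 := by
      rcases inr_mem_genIndex.1 hp with rfl | h
      · exact hs₀.le
      · omega
    have := Nat.mul_le_mul_right b h1
    rw [add_mul, one_mul] at this
    omega

/-- The forms of the generating set are linearly independent modulo the product of the Rees ideal
with the irrelevant maximal ideal, so that no generating set has fewer elements. -/
theorem card_genIndex_le_encard (hn : n ≠ 2) (hb : 0 < b) (hab : b < a) (hrb : r * b < a)
    (hs₀ : s₀.card = r + 1) {T : Set (S k n)} (hT : Ideal.span T = reesIdeal k n a b) :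
    ((genIndex r s₀).card : ℕ∞) ≤ T.encard := by
  classical
  by_cases hfin : T.Finite
  swap
  · rw [Set.Infinite.encard_eq hfin]
    exact le_top
  let Λ : S k n →ₗ[k] (genIndex r s₀ → k) := LinearMap.pi fun p => lcoeff k (indexExp a b p.1)
  have hΛ : ∀ f ∈ Ideal.span T, Λ f ∈ Submodule.span k (Λ '' T) := by
    intro f hf
    induction hf using Submodule.span_induction with
    | mem f hf => exact Submodule.subset_span ⟨f, hf, rfl⟩
    | zero => rw [map_zero]; exact zero_mem _
    | add f g _ _ hf hg => rw [map_add]; exact add_mem hf hg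
    | smul c f hf h =>
      have : Λ (c • f) = constantCoeff c • Λ f := by
        funext p
        exact (isIsolated_indexExp hn hb hrb hs₀ p.2).coeff_mul c (hT ▸ hf)
      rw [this]
      exact Submodule.smul_mem _ _ h
  have htop : Submodule.span k (Λ '' T) = ⊤ := by
    rw [eq_top_iff, ← (Pi.basisFun k (genIndex r s₀)).span_eq, Submodule.span_le]
    rintro _ ⟨p, rfl⟩
    have h1 := hΛ (indexForm k a b p.1) (hT ▸ indexForm_mem p.1)
    have h2 : Λ (indexForm k a b p.1) = Pi.basisFun k (genIndex r s₀) p := by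
      funext q
      rw [Pi.basisFun_apply, Pi.single_apply]
      refine (coeff_indexForm hb hab hrb hs₀ q.2 p.2).trans ?_
      exact if_congr Subtype.ext_iff.symm rfl rfl
    rwa [h2] at h1
  have h1 := finrank_span_finset_le_card (R := k) (hfin.toFinset.image Λ)
  rw [Set.finrank, Finset.coe_image, Set.Finite.coe_toFinset, htop, finrank_top,
    Module.finrank_fintype_fun_eq_card, Fintype.card_coe] at h1
  rw [hfin.encard_eq_coe_toFinset_card]
  exact_mod_cast h1.trans Finset.card_image_le

end Index

/-! ### The relation type -/

section RelationType

variable {k : Type*} [Field k] {n a b r : ℕ}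

theorem isWeightedHomogeneous_koszul (i j : Fin n) :
    IsWeightedHomogeneous (extWeight n) (koszul k a i j) 1 := by
  rw [koszul_eq]
  refine (weightedHomogeneousSubmodule k _ 1).sub_mem ?_ ?_ <;>
  exact isWeightedHomogeneous_monomial _ _ _ (by rw [weight_extWeight, extDeg_koszulExp])

theorem isWeightedHomogeneous_sylvBinomial (s : Finset (Fin n)) :
    IsWeightedHomogeneous (extWeight n) (sylvBinomial k a b s) s.card := by
  rw [sylvBinomial_eq]
  refine (weightedHomogeneousSubmodule k _ _).sub_mem ?_ ?_
  · exact isWeightedHomogeneous_monomial _ _ _ (by rw [weight_extWeight, extDeg_wExp])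
  · exact isWeightedHomogeneous_monomial _ _ _ (by rw [weight_extWeight, extDeg_yExp])

theorem relationType_eq (hb : 0 < b) (hrb : r * b < a) (hr : a ≤ (r + 1) * b ∨ r + 1 = n)
    (hrn : r + 1 ≤ n) : relationType k n a b = r + 1 := by
  classical
  obtain ⟨s₀, -, hs₀⟩ := Finset.exists_subset_card_eq (s := (Finset.univ : Finset (Fin n)))
    (n := r + 1) (by simpa using hrn)
  have hmem : r + 1 ∈ {N : ℕ | Ideal.span {f : S k n | f ∈ reesIdeal k n a b ∧
      ∃ d ≤ N, IsWeightedHomogeneous (extWeight n) f d} = reesIdeal k n a b} := by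
    refine le_antisymm (Ideal.span_le.2 fun f hf => hf.1) ?_
    rw [← span_generators (k := k) hrb hr hs₀]
    refine Ideal.span_mono fun f hf => ⟨?_, ?_⟩
    · exact Ideal.subset_span hf
    · rcases hf with (⟨i, j, -, rfl⟩ | ⟨s, -, h, rfl⟩) | rfl
      · exact ⟨1, by omega, isWeightedHomogeneous_koszul i j⟩
      · exact ⟨s.card, by omega, isWeightedHomogeneous_sylvBinomial s⟩
      · exact ⟨s₀.card, hs₀.le, isWeightedHomogeneous_sylvBinomial s₀⟩
  refine le_antisymm (Nat.sInf_le hmem) (le_csInf ⟨_, hmem⟩ fun N hN => ?_)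
  by_contra! hlt
  have hiso : IsIsolated a b (wExp a b s₀) := by
    refine isIsolated_wExp hb ?_
    rw [hs₀, add_mul, one_mul]
    omega
  -- The coefficient at the isolated monomial of `H_{s₀}` vanishes on all forms of smaller degree.
  have hzero : ∀ f ∈ Ideal.span {f : S k n | f ∈ reesIdeal k n a b ∧
      ∃ d ≤ N, IsWeightedHomogeneous (extWeight n) f d}, coeff (wExp a b s₀) f = 0 := by
    intro f hf
    induction hf using Submodule.span_induction with
    | mem f hf =>
      obtain ⟨-, d, hd, hfd⟩ := hf
      by_contra hc
      have := hfd hc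
      rw [weight_extWeight, extDeg_wExp] at this
      omega
    | zero => rw [coeff_zero]
    | add f g _ _ hf hg => rw [coeff_add, hf, hg, add_zero]
    | smul c f hf h =>
      rw [smul_eq_mul, hiso.coeff_mul c (hN ▸ hf), h, mul_zero]
  have h1 := hzero (sylvBinomial k a b s₀) (hN.ge (sylvBinomial_mem s₀))
  have h2 : yExp a b s₀ ≠ wExp a b s₀ := by
    intro h
    have := DFunLike.congr_fun h RVar.w
    simp only [yExp, wExp, expo_w] at this
    omega
  rw [sylvBinomial_eq, coeff_sub, coeff_monomial, coeff_monomial, if_pos rfl, if_neg h2] at h1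
  simp at h1

end RelationType

/-! ### The reduction number -/

section Reduction

variable {k : Type*} [Field k] {n a b : ℕ}

theorem reductionNumberWrt_eq {A : Type*} [CommRing A] {J I : Ideal A} {r : ℕ}
    (h : J * I ^ r = I ^ (r + 1)) (h' : ∀ m < r, J * I ^ m ≠ I ^ (m + 1)) :
    reductionNumberWrt J I = r :=
  le_antisymm (Nat.sInf_le h) (le_csInf ⟨r, h⟩ fun m hm => by
    by_contra! hc
    exact h' m hc hm)

/-- If `I = J + (c)` and `c^(r+1) ∈ J I^r`, then `J I^r = I^(r+1)`. -/
theorem mul_pow_eq_of_pow_mem {A : Type*} [CommRing A] {J I : Ideal A} {c : A} (hJ : J ≤ I)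
    (hcI : c ∈ I) (hI : I ≤ J ⊔ Ideal.span {c}) {r : ℕ} (hc : c ^ (r + 1) ∈ J * I ^ r) :
    J * I ^ r = I ^ (r + 1) := by
  have key : ∀ m, I ^ (m + 1) ≤ J * I ^ m ⊔ Ideal.span {c ^ (m + 1)} := by
    intro m
    induction m with
    | zero => simpa using hI
    | succ m ih =>
      calc I ^ (m + 1 + 1) = I * I ^ (m + 1) := pow_succ' _ _
        _ ≤ (J ⊔ Ideal.span {c}) * I ^ (m + 1) := Ideal.mul_mono_left hI
        _ = J * I ^ (m + 1) ⊔ Ideal.span {c} * I ^ (m + 1) := Ideal.sup_mul _ _ _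
        _ ≤ J * I ^ (m + 1) ⊔ Ideal.span {c ^ (m + 1 + 1)} := by
          refine sup_le le_sup_left ?_
          calc Ideal.span {c} * I ^ (m + 1)
              ≤ Ideal.span {c} * (J * I ^ m ⊔ Ideal.span {c ^ (m + 1)}) := Ideal.mul_mono_right ih
            _ = J * (Ideal.span {c} * I ^ m) ⊔ Ideal.span {c ^ (m + 1 + 1)} := by
              rw [Ideal.mul_sup, Ideal.span_singleton_mul_span_singleton, mul_left_comm,
                ← pow_succ']
            _ ≤ J * I ^ (m + 1) ⊔ Ideal.span {c ^ (m + 1 + 1)} := by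
              rw [pow_succ' I]
              exact sup_le_sup_right (Ideal.mul_mono_right
                (Ideal.mul_mono_left ((Ideal.span_singleton_le_iff_mem _).2 hcI))) _
  refine le_antisymm ?_ ((key r).trans (sup_le le_rfl ((Ideal.span_singleton_le_iff_mem _).2 hc)))
  rw [pow_succ']
  exact Ideal.mul_mono_left hJ

theorem uniformIdeal_le {J : Ideal (R k n)} (hx : ∀ i, (X i : R k n) ^ a ∈ J)
    (hc : (∏ i : Fin n, (X i : R k n)) ^ b ∈ J) : uniformIdeal k n a b ≤ J := by
  refine Ideal.span_le.2 ?_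
  rintro f (⟨i, rfl⟩ | rfl)
  exacts [hx i, hc]

theorem uniformReduction_le : uniformReduction k n a b ≤ uniformIdeal k n a b := by
  rw [uniformReduction]
  split_ifs
  · exact Ideal.span_mono Set.subset_union_left
  · refine Ideal.span_le.2 ?_
    rintro f (⟨i, l, -, rfl⟩ | rfl)
    · exact sub_mem (pow_mem_uniformIdeal k n a b i) (pow_mem_uniformIdeal k n a b l)
    · exact prod_mem_uniformIdeal k n a b

/-- If `a ≤ n b`, then `r + 1` is the least `p` with `a ≤ p b`. -/
theorem redNumber_eq_of_le {r : ℕ} (h : a ≤ n * b) (hrb : r * b < a) (hr : a ≤ (r + 1) * b)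
    (hrn : r + 1 ≤ n) : uniformReduction k n a b * uniformIdeal k n a b ^ r
      = uniformIdeal k n a b ^ (r + 1) ∧ redNumber k n a b = r := by
  classical
  have hQ : uniformReduction k n a b = Ideal.span (Set.range fun i : Fin n => (X i : R k n) ^ a) :=
    if_pos h
  have hx : ∀ i, (X i : R k n) ^ a ∈ uniformReduction k n a b := fun i =>
    hQ ▸ Ideal.subset_span ⟨i, rfl⟩
  have h1 : uniformReduction k n a b * uniformIdeal k n a b ^ r
      = uniformIdeal k n a b ^ (r + 1) := by
    refine mul_pow_eq_of_pow_mem (c := (∏ i : Fin n, (X i : R k n)) ^ b) uniformReduction_le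
      (prod_mem_uniformIdeal k n a b)
      (uniformIdeal_le (fun i => Ideal.mem_sup_left (hx i))
        (Ideal.mem_sup_right (Ideal.mem_span_singleton_self _))) ?_
    -- The power `c ^ (r + 1)` is divisible by `x_i ^ a` for all `i`.
    obtain ⟨s, -, hs⟩ := Finset.exists_subset_card_eq (s := (Finset.univ : Finset (Fin n)))
      (n := r + 1) (by simpa using hrn)
    have h2 : ∏ i ∈ s, (X i : R k n) ^ a ∣ ((∏ i : Fin n, (X i : R k n)) ^ b) ^ (r + 1) := by
      rw [← pow_mul, mul_comm b, Finset.prod_pow]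
      exact (pow_dvd_pow_of_dvd (Finset.prod_dvd_prod_of_subset _ _ _ (Finset.subset_univ s)) a).trans
        (pow_dvd_pow _ hr)
    refine Ideal.mem_of_dvd _ h2 ?_
    have h3 : ∏ i ∈ s, (X i : R k n) ^ a ∈ uniformReduction k n a b ^ (r + 1) := by
      rw [← hs, ← Finset.prod_const]
      exact Ideal.prod_mem_prod fun i _ => hx i
    rw [pow_succ'] at h3
    exact Ideal.mul_mono_right (Ideal.pow_right_mono uniformReduction_le r) h3
  refine ⟨h1, reductionNumberWrt_eq h1 fun m hm he => ?_⟩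
  -- The exponents of `c ^ (m + 1)` are smaller than `a`.
  have h2 : ((∏ i : Fin n, (X i : R k n)) ^ b) ^ (m + 1) ∈ uniformReduction k n a b := by
    have := Ideal.pow_mem_pow (prod_mem_uniformIdeal k n a b) (m + 1)
    rw [← he] at this
    exact Ideal.mul_le_left this
  have h3 : ((∏ i : Fin n, (X i : R k n)) ^ b) ^ (m + 1)
      = monomial (Finsupp.equivFunOnFinite.symm fun _ => b * (m + 1)) 1 := by
    rw [monomial_eq, C_1, one_mul, Finsupp.prod_fintype _ _ (fun _ => pow_zero _), ← pow_mul]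
    simp [Finset.prod_pow]
  have h4 : (Set.range fun i : Fin n => (X i : R k n) ^ a)
      = (fun e => monomial e (1 : k)) '' Set.range fun i : Fin n => Finsupp.single i a := by
    rw [← Set.range_comp]
    congr 1
    funext i
    simp [X_pow_eq_monomial]
  rw [h3, hQ, h4, mem_ideal_span_monomial_image] at h2
  obtain ⟨_, ⟨i, rfl⟩, hi⟩ := h2 (Finsupp.equivFunOnFinite.symm fun _ => b * (m + 1))
    (by simp [mem_support_iff])
  have h5 := Finsupp.single_le_iff.1 hi
  have h6 : (m + 1) * b ≤ r * b := Nat.mul_le_mul_right b hm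
  rw [Finsupp.equivFunOnFinite_symm_apply_apply, mul_comm] at h5
  omega

/-- The functional on `R` with value `1` at the monomials in the `x_i^a` of degree `N` in these,
and value `0` at all other monomials. -/
def powFunctional (k : Type*) [Field k] (n a N : ℕ) : R k n →ₗ[k] k :=
  open Classical in
  (basisMonomials (Fin n) k).constr k fun α => if (∀ i, a ∣ α i) ∧ ∑ i, α i = a * N then 1 else 0

open Classical in
theorem powFunctional_monomial (N : ℕ) (α : Fin n →₀ ℕ) (c : k) :
    powFunctional k n a N (monomial α c)
      = c * if (∀ i, a ∣ α i) ∧ ∑ i, α i = a * N then 1 else 0 := by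
  have h1 : (monomial α c : R k n) = c • basisMonomials (Fin n) k α := by
    rw [coe_basisMonomials, smul_monomial, smul_eq_mul, mul_one]
  rw [h1, map_smul, powFunctional, Module.Basis.constr_basis, smul_eq_mul]

/-- Multiplication by `x_i^a` changes the value of the functional in a way independent of `i`. -/
theorem powFunctional_X_pow (N : ℕ) (i j : Fin n) (f : R k n) :
    powFunctional k n a N (f * X i ^ a) = powFunctional k n a N (f * X j ^ a) := by
  classical
  have key : ∀ (i : Fin n) (α : Fin n →₀ ℕ), ((∀ l, a ∣ (α + Finsupp.single i a) l) ∧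
      ∑ l, (α + Finsupp.single i a) l = a * N) ↔ (∀ l, a ∣ α l) ∧ ∑ l, α l + a = a * N := by
    intro i α
    refine and_congr (forall_congr' fun l => ?_) ?_
    · rw [Finsupp.add_apply, Finsupp.single_apply]
      split_ifs <;> simp
    · simp [Finset.sum_add_distrib, Finsupp.single_apply]
  induction f using MvPolynomial.induction_on' with
  | monomial α c =>
    rw [X_pow_eq_monomial, X_pow_eq_monomial, monomial_mul, monomial_mul, mul_one,
      powFunctional_monomial, powFunctional_monomial]
    simp only [key]
  | add p q hp hq => rw [add_mul, add_mul, map_add, map_add, hp, hq]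

theorem powFunctional_prod_pow (ha : 0 < a) (hb : 0 < b) {N : ℕ} (hN : N < n) (f : R k n) :
    powFunctional k n a N (f * (∏ i : Fin n, (X i : R k n)) ^ b) = 0 := by
  classical
  have h3 : (∏ i : Fin n, (X i : R k n)) ^ b
      = monomial (Finsupp.equivFunOnFinite.symm fun _ => b) 1 := by
    rw [monomial_eq, C_1, one_mul, Finsupp.prod_fintype _ _ (fun _ => pow_zero _)]
    simp [Finset.prod_pow]
  induction f using MvPolynomial.induction_on' with
  | monomial α c =>
    rw [h3, monomial_mul, mul_one, powFunctional_monomial, if_neg, mul_zero]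
    rintro ⟨h1, h2⟩
    have h4 : ∀ i, a ≤ α i + b := fun i => Nat.le_of_dvd (by omega) (h1 i)
    have h5 : ∑ _i : Fin n, a ≤ a * N := by
      rw [← h2]
      exact Finset.sum_le_sum fun i _ => h4 i
    rw [Finset.sum_const, Finset.card_univ, Fintype.card_fin, smul_eq_mul, mul_comm n] at h5
    exact absurd (Nat.le_of_mul_le_mul_left h5 ha) (not_le.2 hN)
  | add p q hp hq => rw [add_mul, map_add, hp, hq, add_zero]

/-- If all `u i ∈ I` are congruent to `z ∈ I` modulo `J`, then products of `d` of them are congruent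
to `z ^ d` modulo `J I^(d - 1)`. For `d = 0` the truncated exponent is harmless. -/
theorem prod_sub_pow_mem {A ι : Type*} [CommRing A] {J I : Ideal A} (u : ι → A) (z : A)
    (hu : ∀ i, u i ∈ I) (hz : z ∈ I) (h : ∀ i, u i - z ∈ J) (s : Finset ι) :
    (∏ i ∈ s, u i) - z ^ s.card ∈ J * I ^ (s.card - 1) := by
  classical
  induction s using Finset.induction_on with
  | empty => simp
  | insert i s hi ih =>
    rw [Finset.prod_insert hi, Finset.card_insert_of_notMem hi, Nat.add_sub_cancel]
    have e : u i * ∏ j ∈ s, u j - z ^ (s.card + 1)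
        = (u i - z) * ∏ j ∈ s, u j + z * ((∏ j ∈ s, u j) - z ^ s.card) := by ring
    rw [e]
    refine add_mem (Ideal.mul_mem_mul (h i) ?_) ?_
    · rw [← Finset.prod_const]
      exact Ideal.prod_mem_prod fun j _ => hu j
    · rcases Nat.eq_zero_or_pos s.card with h0 | h0
      · rw [Finset.card_eq_zero.1 h0]
        simp
      · have := Ideal.mul_mem_mul hz ih
        rwa [mul_left_comm, ← pow_succ', Nat.sub_add_cancel h0] at this

/-- If `n b < a`, then the reduction number is `n - 1`. -/
theorem redNumber_eq_of_lt {r : ℕ} (hb : 0 < b) (h : n * b < a) (hrn : r + 1 = n) :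
    uniformReduction k n a b * uniformIdeal k n a b ^ r
      = uniformIdeal k n a b ^ (r + 1) ∧ redNumber k n a b = r := by
  have hQ : uniformReduction k n a b
      = Ideal.span ({f : R k n | ∃ i l : Fin n, l.val + 1 = n ∧ f = X i ^ a - X l ^ a} ∪
      {(∏ i : Fin n, (X i : R k n)) ^ b}) := if_neg (not_le.2 h)
  let l : Fin n := ⟨r, by omega⟩
  have hx : ∀ i, (X i : R k n) ^ a - X l ^ a ∈ uniformReduction k n a b := fun i =>
    hQ ▸ Ideal.subset_span (Or.inl ⟨i, l, hrn, rfl⟩)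
  have hc : (∏ i : Fin n, (X i : R k n)) ^ b ∈ uniformReduction k n a b :=
    hQ ▸ Ideal.subset_span (Or.inr rfl)
  have h1 : uniformReduction k n a b * uniformIdeal k n a b ^ r
      = uniformIdeal k n a b ^ (r + 1) := by
    refine mul_pow_eq_of_pow_mem (c := (X l : R k n) ^ a) uniformReduction_le
      (pow_mem_uniformIdeal k n a b l)
      (uniformIdeal_le (fun i => ?_) (Ideal.mem_sup_left hc)) ?_
    · rw [← sub_add_cancel ((X i : R k n) ^ a) (X l ^ a)]
      exact add_mem (Ideal.mem_sup_left (hx i))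
        (Ideal.mem_sup_right (Ideal.mem_span_singleton_self _))
    · -- Modulo `Q I ^ r`, the power `x_n ^ (a n)` is the product of all `x_i ^ a`, which is
      -- divisible by `c ^ n` for `c = (x_1 ⋯ x_n) ^ b`.
      have h2 := prod_sub_pow_mem (fun i => (X i : R k n) ^ a) (X l ^ a)
        (pow_mem_uniformIdeal k n a b) (pow_mem_uniformIdeal k n a b l) hx Finset.univ
      rw [Finset.card_univ, Fintype.card_fin, show n - 1 = r by omega] at h2
      have h3 : ∏ i, (X i : R k n) ^ a ∈ uniformReduction k n a b * uniformIdeal k n a b ^ r := by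
        refine Ideal.mem_of_dvd _ (a := ((∏ i : Fin n, (X i : R k n)) ^ b) ^ (r + 1)) ?_ ?_
        · rw [Finset.prod_pow, ← pow_mul]
          exact pow_dvd_pow _ (by rw [mul_comm, hrn]; exact h.le)
        · rw [pow_succ']
          exact Ideal.mul_mem_mul hc (Ideal.pow_mem_pow (prod_mem_uniformIdeal k n a b) r)
      have := sub_mem h3 h2
      rw [sub_sub_cancel] at this
      exact (congrArg (fun N => ((X l : R k n) ^ a) ^ N) hrn).symm ▸ this
  refine ⟨h1, reductionNumberWrt_eq h1 fun m hm he => ?_⟩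
  -- The functional vanishes on `Q`, but not at `x_n ^ (a (m + 1))`.
  have h2 : ((X l : R k n) ^ a) ^ (m + 1) ∈ uniformReduction k n a b := by
    have := Ideal.pow_mem_pow (pow_mem_uniformIdeal k n a b l) (m + 1)
    rw [← he] at this
    exact Ideal.mul_le_left this
  have hvan : ∀ f ∈ uniformReduction k n a b, ∀ g, powFunctional k n a (m + 1) (g * f) = 0 := by
    intro f hf
    rw [hQ] at hf
    induction hf using Submodule.span_induction with
    | mem f hf =>
      intro g
      rcases hf with ⟨i, j, -, rfl⟩ | rfl
      · rw [mul_sub, map_sub, powFunctional_X_pow _ i j, sub_self]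
      · exact powFunctional_prod_pow (by omega) hb (by omega) g
    | zero => simp
    | add f f' _ _ hf hf' => intro g; rw [mul_add, map_add, hf, hf', add_zero]
    | smul c f _ hf => intro g; rw [smul_eq_mul, ← mul_assoc, hf]
  have h3 := hvan _ h2 1
  rw [one_mul, ← pow_mul, X_pow_eq_monomial, powFunctional_monomial, if_pos] at h3
  · simp at h3
  · refine ⟨fun i => ?_, ?_⟩
    · rw [Finsupp.single_apply]
      split_ifs
      exacts [dvd_mul_right _ _, dvd_zero a]
    · simp [Finsupp.single_apply]

/-- With `r` the reduction number, `r + 1` is the least `p` such that `a ≤ p b` or `p = n`. -/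
theorem redNumber_spec (hn : 0 < n) (hb : 0 < b) (hab : b < a) :
    uniformReduction k n a b * uniformIdeal k n a b ^ redNumber k n a b
        = uniformIdeal k n a b ^ (redNumber k n a b + 1) ∧
      redNumber k n a b + 1 ≤ n ∧ redNumber k n a b * b < a ∧
      (a ≤ (redNumber k n a b + 1) * b ∨ redNumber k n a b + 1 = n) := by
  by_cases h : a ≤ n * b
  · have hex : ∃ p, a ≤ p * b := ⟨n, h⟩
    obtain ⟨r, hr⟩ : ∃ r, Nat.find hex = r + 1 := Nat.exists_eq_succ_of_ne_zero fun h0 => by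
      have := Nat.find_spec hex
      rw [h0] at this
      omega
    have h1 : a ≤ (r + 1) * b := hr ▸ Nat.find_spec hex
    have h2 : r * b < a := not_le.1 (Nat.find_min hex (by omega))
    have h3 : r + 1 ≤ n := hr ▸ Nat.find_min' hex h
    obtain ⟨h4, h5⟩ := redNumber_eq_of_le (k := k) h h2 h1 h3
    rw [h5]
    exact ⟨h4, h3, h2, Or.inl h1⟩
  · obtain ⟨r, rfl⟩ : ∃ r, n = r + 1 := Nat.exists_eq_succ_of_ne_zero hn.ne'
    rw [not_le] at h
    obtain ⟨h4, h5⟩ := redNumber_eq_of_lt (k := k) hb h rfl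
    rw [h5]
    refine ⟨h4, le_rfl, ?_, Or.inr rfl⟩
    rw [add_mul] at h
    omega

end Reduction

/-! ### Homogeneity for the weights of `x_i`, `y_j`, `w` -/

section Weights

variable {k : Type*} [Field k] {n a b : ℕ}

theorem exists_isWeightedHomogeneous_koszul (i j : Fin n) :
    ∃ d, IsWeightedHomogeneous (quasiWeight n a b) (koszul k a i j) d := by
  refine ⟨a + quasiWeight n a b (RVar.y j), ?_⟩
  rw [koszul]
  have h : ∀ i j : Fin n, IsWeightedHomogeneous (quasiWeight n a b)
      (X (RVar.x i) ^ a * X (RVar.y j) : S k n) (a + quasiWeight n a b (RVar.y j)) := by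
    intro i j
    have := ((isWeightedHomogeneous_X k (quasiWeight n a b) (RVar.x i)).pow a).mul
      (isWeightedHomogeneous_X k (quasiWeight n a b) (RVar.y j))
    simpa [quasiWeight] using this
  exact (h i j).sub (h j i)

theorem weight_quasiWeight_wExp (s : Finset (Fin n)) :
    Finsupp.weight (quasiWeight n a b) (wExp a b s)
      = Finsupp.weight (quasiWeight n a b) (yExp a b s) := by
  rw [Finsupp.weight_apply, Finsupp.sum_fintype _ _ (fun _ => by simp), RVar.sum_univ,
    Finsupp.weight_apply, Finsupp.sum_fintype _ _ (fun _ => by simp), RVar.sum_univ]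
  have hc : s.card ≤ n := by simpa using s.card_le_univ
  have h' : (Finset.univ.filter fun i : Fin n => i ∈ s) = s := by ext; simp
  have h : (Finset.univ.filter fun i : Fin n => i ∉ s) = sᶜ := by ext; simp
  have e : n * b = s.card * b + (n - s.card) * b := by
    rw [← add_mul, Nat.add_sub_cancel' hc]
  have hy : ∀ c, ∑ i, (if i ∈ s then 1 else 0) * c = s.card * c := by
    intro c
    rw [← Finset.sum_mul]
    simp
  simp only [wExp, yExp, expo_x, expo_y, expo_w, quasiWeight, smul_eq_mul, mul_one, zero_mul,
    Finset.sum_const_zero, add_zero, Finset.sum_ite, h, h', Finset.sum_const, Finset.card_compl,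
    Fintype.card_fin]
  have e' : (n - s.card) * (s.card * b) = s.card * ((n - s.card) * b) := by ring
  rw [e', hy, ← mul_add, ← mul_add, ← mul_add]
  congr 1
  split_ifs <;> omega

theorem exists_isWeightedHomogeneous_sylvBinomial (s : Finset (Fin n)) :
    ∃ d, IsWeightedHomogeneous (quasiWeight n a b) (sylvBinomial k a b s) d := by
  refine ⟨Finsupp.weight (quasiWeight n a b) (wExp a b s), ?_⟩
  rw [sylvBinomial_eq]
  exact (isWeightedHomogeneous_monomial _ _ _ rfl).sub
    (isWeightedHomogeneous_monomial _ _ _ (weight_quasiWeight_wExp s).symm)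

end Weights

/-! ### The generators as iterated Sylvester forms -/

section Sylvester

variable {k : Type*} [Field k] {n a b : ℕ}

theorem isRegular_prime_pow {A : Type*} [CommRing A] [IsDomain A] {p v : A} (hp : Prime p)
    (hv : ¬ p ∣ v) (m : ℕ) (htop : Ideal.span {p ^ m} ⊔ Ideal.span {v} ≠ ⊤) :
    RingTheory.Sequence.IsRegular A [p ^ m, v] := by
  rw [RingTheory.Sequence.isRegular_iff]
  refine ⟨?_, ?_⟩
  · rw [RingTheory.Sequence.isWeaklyRegular_cons_iff,
      RingTheory.Sequence.isWeaklyRegular_singleton_iff]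
    refine ⟨fun x y h => mul_left_cancel₀ (pow_ne_zero m hp.ne_zero) h, ?_⟩
    refine (isSMulRegular_quotient_iff_mem_of_smul_mem _ _).2 fun x hx => ?_
    rw [Submodule.mem_smul_pointwise_iff_exists] at hx ⊢
    obtain ⟨y, -, hy⟩ := hx
    obtain ⟨z, hz⟩ := hp.pow_dvd_of_dvd_mul_left m hv ⟨y, hy.symm⟩
    exact ⟨z, Submodule.mem_top, hz.symm⟩
  · rw [smul_eq_mul, Ideal.mul_top, Ideal.ofList_cons, Ideal.ofList_singleton]
    exact htop.symm

theorem isRegular_X_pow_prod_pow {s : Finset (Fin n)} (hs : s.Nonempty) {i : Fin n} (hi : i ∉ s)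
    {m m' : ℕ} (hm : m ≠ 0) (hm' : m' ≠ 0) :
    RingTheory.Sequence.IsRegular (R k n) [(X i : R k n) ^ m, (∏ j ∈ s, X j) ^ m'] := by
  have hX : Prime (X i : R k n) := X_prime
  refine isRegular_prime_pow hX (fun h => ?_) m ?_
  · obtain ⟨j, hj, hd⟩ := (hX.dvd_finsetProd_iff _).1 (hX.dvd_of_dvd_pow h)
    exact hi ((X_dvd_X (R := k)).1 hd ▸ hj)
  · have hle : Ideal.span {(X i : R k n) ^ m} ⊔ Ideal.span {(∏ j ∈ s, (X j : R k n)) ^ m'}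
        ≤ RingHom.ker (constantCoeff : R k n →+* k) := by
      obtain ⟨j, hj⟩ := hs
      refine sup_le ?_ ?_ <;> rw [Ideal.span_singleton_le_iff_mem, RingHom.mem_ker, map_pow]
      · rw [constantCoeff_X, zero_pow hm]
      · rw [map_prod, Finset.prod_eq_zero hj (constantCoeff_X _ j), zero_pow hm']
    exact fun h => RingHom.ker_ne_top (constantCoeff : R k n →+* k) (top_le_iff.1 (h ▸ hle))

theorem isWeightedHomogeneous_rename_x (p : R k n) :
    IsWeightedHomogeneous (extWeight n) (rename RVar.x p) 0 := by
  induction p using MvPolynomial.induction_on with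
  | C c => rw [rename_C]; exact isWeightedHomogeneous_C _ c
  | add p q hp hq => rw [map_add]; exact hp.add hq
  | mul_X p i hp =>
    rw [map_mul, rename_X]
    exact hp.mul (isWeightedHomogeneous_X k (extWeight n) (RVar.x i))

/-- The form `H_{s ∪ {i}}` is a Sylvester form of `L_i` and `H_s`, with respect to the regular
sequence `x_i ^ min (a - b) (δ b)`, `(∏_{j ∈ s} x_j) ^ min b (a - δ b)`, where `δ = |s|`. -/
theorem isSylvesterForm_sylvBinomial (hb : 0 < b) (hab : b < a) {s : Finset (Fin n)}
    (hs : s.Nonempty) (hsa : s.card * b < a) {i : Fin n} (hi : i ∉ s) :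
    IsSylvesterForm 1 s.card (taylor k a b i) (sylvBinomial k a b s)
      (sylvBinomial k a b (insert i s)) := by
  set δ := s.card with hδ
  have hδb : 0 < δ * b := Nat.mul_pos (Finset.card_pos.2 hs) hb
  set A := a - (δ + 1) * b with hA
  set B := (δ + 1) * b - a with hB
  set m := min (a - b) (δ * b) with hm
  set m' := min b (a - δ * b) with hm'
  have hδ1 : (δ + 1) * b = δ * b + b := by ring
  have e1 : a - b = A + m := by omega
  have e2 : δ * b = B + m := by omega
  have e3 : b = B + m' := by omega
  have e4 : a - δ * b = A + m' := by omega
  let ux : S k n := rename RVar.x (X i)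
  let vx : S k n := rename RVar.x (∏ j ∈ s, X j)
  let P : S k n := rename RVar.x (∏ j ∈ (insert i s)ᶜ, X j)
  have hux : ux = X (RVar.x i) := by simp [ux]
  have hvx : vx = ∏ j ∈ s, X (RVar.x j) := by simp [vx]
  have hP : P = ∏ j ∈ (insert i s)ᶜ, X (RVar.x j) := by simp [P]
  let Y : S k n := ∏ j ∈ s, X (RVar.y j)
  have hY : IsWeightedHomogeneous (extWeight n) Y δ := by
    have := IsWeightedHomogeneous.prod s (fun j => (X (RVar.y j) : S k n)) (fun _ => 1)
      (w := extWeight n) fun j _ => isWeightedHomogeneous_X k (extWeight n) (RVar.y j)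
    simpa using this
  have hW : IsWeightedHomogeneous (extWeight n) (X RVar.w ^ δ : S k n) δ := by
    have := (isWeightedHomogeneous_X k (extWeight n) RVar.w).pow δ
    simpa [extWeight] using this
  have h0 : ∀ (p : R k n) {q : S k n} {d : ℕ}, IsWeightedHomogeneous (extWeight n) q d →
      IsWeightedHomogeneous (extWeight n) (rename RVar.x p * q) d := by
    intro p q d hq
    have := (isWeightedHomogeneous_rename_x p).mul hq
    rwa [zero_add] at this
  have hPi : ∏ j ∈ ({i}ᶜ : Finset (Fin n)), (X (RVar.x j) : S k n) = vx * P := by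
    rw [hvx, hP, ← Finset.prod_union]
    · congr 1
      ext j
      simp only [Finset.mem_compl, Finset.mem_singleton, Finset.mem_union, Finset.mem_insert]
      by_cases hj : j = i
      · simp [hj, hi]
      · simp only [hj, not_false_eq_true, false_or, true_iff]
        exact em _
    · exact Finset.disjoint_left.2 fun j hj hj' =>
        Finset.mem_compl.1 hj' (Finset.mem_insert_of_mem hj)
  have hPs : ∏ j ∈ sᶜ, (X (RVar.x j) : S k n) = ux * P := by
    rw [hux, hP, Finset.compl_insert, Finset.mul_prod_erase sᶜ (fun j => (X (RVar.x j) : S k n))]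
    simpa using hi
  have hL : taylor k a b i = ux ^ (A + m) * X RVar.w - (vx * P) ^ b * X (RVar.y i) := by
    rw [taylor, hPi, hux, e1]
  have hH : sylvBinomial k a b s
      = vx ^ (A + m') * X RVar.w ^ δ - (ux * P) ^ (δ * b) * Y := by
    rw [sylvBinomial, hPs, ← hδ, Nat.sub_eq_zero_of_le hsa.le, pow_zero, mul_one, hvx, e4]
  refine ⟨X i ^ m, (∏ j ∈ s, X j) ^ m',
    isRegular_X_pow_prod_pow hs hi (by omega) (by omega),
    !![rename RVar.x (X i ^ A) * X RVar.w,
        rename RVar.x (-((∏ j ∈ s, X j) ^ B * (∏ j ∈ (insert i s)ᶜ, X j) ^ b)) * X (RVar.y i);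
      rename RVar.x (-(X i ^ B * (∏ j ∈ (insert i s)ᶜ, X j) ^ (δ * b))) * Y,
        rename RVar.x ((∏ j ∈ s, X j) ^ A) * X RVar.w ^ δ], ?_, ?_, ?_, ?_⟩
  · intro j
    fin_cases j
    · exact h0 _ (isWeightedHomogeneous_X k (extWeight n) RVar.w)
    · exact h0 _ (isWeightedHomogeneous_X k (extWeight n) (RVar.y i))
  · intro j
    fin_cases j
    exacts [h0 _ hY, h0 _ hW]
  · rw [hL, hH]
    simp only [map_neg, map_mul, map_pow]
    have h1 : (vx * P) ^ b = vx ^ B * vx ^ m' * P ^ b := by rw [mul_pow, ← pow_add, ← e3]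
    have h2 : (ux * P) ^ (δ * b) = ux ^ B * ux ^ m * P ^ (δ * b) := by
      rw [mul_pow, ← pow_add, ← e2]
    rw [h1, h2]
    funext j
    fin_cases j
    · simp only [Matrix.mulVec, dotProduct, Fin.sum_univ_two]
      change ux ^ A * X RVar.w * ux ^ m + -(vx ^ B * P ^ b) * X (RVar.y i) * vx ^ m'
        = ux ^ (A + m) * X RVar.w - vx ^ B * vx ^ m' * P ^ b * X (RVar.y i)
      ring
    · simp only [Matrix.mulVec, dotProduct, Fin.sum_univ_two]
      change -(ux ^ B * P ^ (δ * b)) * Y * ux ^ m + vx ^ A * X RVar.w ^ δ * vx ^ m'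
        = vx ^ (A + m') * X RVar.w ^ δ - ux ^ B * ux ^ m * P ^ (δ * b) * Y
      ring
  · rw [Matrix.det_fin_two_of, sylvBinomial, Finset.card_insert_of_notMem hi, ← hδ,
      Finset.prod_insert hi, Finset.prod_insert hi, ← hP, ← hvx, ← hux]
    simp only [map_neg, map_mul, map_pow]
    change (ux * vx) ^ A * X RVar.w ^ (δ + 1)
        - P ^ ((δ + 1) * b) * (ux * vx) ^ B * (X (RVar.y i) * Y)
      = ux ^ A * X RVar.w * (vx ^ A * X RVar.w ^ δ)
        - -(vx ^ B * P ^ b) * X (RVar.y i) * (-(ux ^ B * P ^ (δ * b)) * Y)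
    rw [hδ1]
    ring

theorem isIteratedSylvesterForm_sylvBinomial (hb : 0 < b) (hab : b < a) {s : Finset (Fin n)}
    (hs : s.Nonempty) (hsa : (s.card - 1) * b < a) :
    IsIteratedSylvesterForm k n a b s.card (sylvBinomial k a b s) := by
  induction hs using Finset.Nonempty.cons_induction with
  | singleton i =>
    have h : sylvBinomial k a b {i} = taylor k a b i := by
      simp [sylvBinomial, taylor, Nat.sub_eq_zero_of_le hab.le]
    rw [h, Finset.card_singleton]
    exact .syzygy _ (Or.inr ⟨i, rfl⟩)
  | cons i s hi hs ih =>
    rw [Finset.cons_eq_insert, Finset.card_insert_of_notMem hi, Nat.add_sub_cancel] at *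
    have h1 : (s.card - 1) * b ≤ s.card * b := Nat.mul_le_mul_right b (Nat.sub_le _ 1)
    exact .step _ _ _ _ (Or.inr ⟨i, rfl⟩) (ih (h1.trans_lt hsa))
      (isSylvesterForm_sylvBinomial hb hab hs hsa hi)

end Sylvester

section Generators

variable {k : Type*} [Field k] {n a b r : ℕ}

theorem isBinomial_of_mem_generators (hb : 0 < b) (hab : b < a) {s₀ : Finset (Fin n)}
    (hs₀ : s₀.card = r + 1) {g : S k n} (hg : g ∈ generators k a b r s₀) : IsBinomial g := by
  rw [generators_eq_image] at hg
  obtain ⟨p, hp, rfl⟩ := hg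
  exact ⟨_, _, indexExp_ne hb hab hs₀ hp hp, indexForm_eq p⟩

theorem isIteratedSylvesterForm_of_mem_generators (hb : 0 < b) (hab : b < a) (hrb : r * b < a)
    {s₀ : Finset (Fin n)} (hs₀ : s₀.card = r + 1) {g : S k n} (hg : g ∈ generators k a b r s₀) :
    ∃ d, IsIteratedSylvesterForm k n a b d g := by
  rcases hg with (⟨i, j, h, rfl⟩ | ⟨s, h1, h2, rfl⟩) | rfl
  · exact ⟨1, .syzygy _ (Or.inl ⟨i, j, h, rfl⟩)⟩
  · refine ⟨_, isIteratedSylvesterForm_sylvBinomial hb hab (Finset.card_pos.1 h1) ?_⟩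
    exact (Nat.mul_le_mul_right b (by omega)).trans_lt hrb
  · refine ⟨_, isIteratedSylvesterForm_sylvBinomial hb hab (Finset.card_pos.1 (by omega)) ?_⟩
    rwa [hs₀, Nat.add_sub_cancel]

theorem exists_isWeightedHomogeneous_of_mem_generators {s₀ : Finset (Fin n)} {g : S k n}
    (hg : g ∈ generators k a b r s₀) :
    ∃ d, IsWeightedHomogeneous (quasiWeight n a b) g d := by
  rcases hg with (⟨i, j, -, rfl⟩ | ⟨s, -, -, rfl⟩) | rfl
  exacts [exists_isWeightedHomogeneous_koszul i j, exists_isWeightedHomogeneous_sylvBinomial s,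
    exists_isWeightedHomogeneous_sylvBinomial s₀]

end Generators

end UniformRees

end

open UniformRees in
theorem theorem1p4 (k : Type*) [Field k] (n a b : ℕ) (hn : 0 < n) (hb : 0 < b) (hab : b < a) :
    -- `r = redNumber k n a b` is attained, and there are index sets with `r + 1` elements
    (uniformReduction k n a b ≤ uniformIdeal k n a b ∧
      uniformReduction k n a b * uniformIdeal k n a b ^ redNumber k n a b
        = uniformIdeal k n a b ^ (redNumber k n a b + 1) ∧
      redNumber k n a b + 1 ≤ n) ∧
    -- (a) generation by the Koszul syzygies, all binomials with `1 ≤ δ ≤ r`, and any one binomial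
    -- with `δ = r + 1`; the number of these generators; minimality
    (koszulForms k n a).ncard = n.choose 2 ∧
    (∀ s₀ : Finset (Fin n), s₀.card = redNumber k n a b + 1 →
      Ideal.span (generators k a b (redNumber k n a b) s₀) = reesIdeal k n a b ∧
      (generators k a b (redNumber k n a b) s₀).ncard
        = n.choose 2 + (∑ δ ∈ Finset.Icc 1 (redNumber k n a b), n.choose δ) + 1 ∧
      (∀ g ∈ generators k a b (redNumber k n a b) s₀,
        IsBinomial g ∧ (∃ d, MvPolynomial.IsWeightedHomogeneous (quasiWeight n a b) g d) ∧
        -- (b) each generator is an iterated Sylvester form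
        ∃ d, IsIteratedSylvesterForm k n a b d g)) ∧
    (n ≠ 2 → ∀ T : Set (S k n), Ideal.span T = reesIdeal k n a b →
      ((n.choose 2 + (∑ δ ∈ Finset.Icc 1 (redNumber k n a b), n.choose δ) + 1 : ℕ) : ℕ∞)
        ≤ T.encard) ∧
    -- (c) the relation type
    relationType k n a b = redNumber k n a b + 1 := by
  obtain ⟨h1, hrn, hrb, hr⟩ := redNumber_spec (k := k) hn hb hab
  refine ⟨⟨uniformReduction_le, h1, hrn⟩, ncard_koszulForms (by omega), fun s₀ hs₀ =>
    ⟨span_generators hrb hr hs₀, ncard_generators hb hab hrb hs₀, fun g hg =>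
      ⟨isBinomial_of_mem_generators hb hab hs₀ hg,
        exists_isWeightedHomogeneous_of_mem_generators hg,
        isIteratedSylvesterForm_of_mem_generators hb hab hrb hs₀ hg⟩⟩,
    fun hn2 T hT => ?_, relationType_eq hb hrb hr hrn⟩
  obtain ⟨s₀, -, hs₀⟩ := Finset.exists_subset_card_eq (s := (Finset.univ : Finset (Fin n)))
    (n := redNumber k n a b + 1) (by simpa using hrn)
  rw [← card_genIndex hs₀]
  exact card_genIndex_le_encard hn2 hb hab hrb hs₀ hT
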